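/- Consider a bipartite scenario in which each of two parties, Alice and Bob, has two binary measurements. Write $\bar{\mathcal I}=\{0,1\}\times\{0,1\}$ for the set of local labels, where $(k,x)$ means outcome $k$ of measurement $x$. Let $\mathcal I\subseteq\bar{\mathcal I}\times\bar{\mathcal I}$ be a set of joint events $i=(i_A,i_B)$ with weights $w_i>0$. Two events are called exclusive, $i\sim j$, if for Alice or for Bob they have different outcomes of one and the same measurement. The Lov\'asz theta program of this weighted graph of exclusivity is $$\max\ \sum_{i\in\mathcal I} w_iX_{ii}\quad\text{s.t.}\quad X_{00}=1,\ \ X_{ii}=X_{0i}\ (i\in\mathcal I),\ \ X_{ij}=0\ (i\sim j),\ \ X\succeq0,$$ where $X$ ranges over Hermitian matrices indexed by $\{0\}\cup\mathcal I$. Reference system. Let $\mathcal H_A=\mathcal H_B=\mathbb C^2$, let $|\psi\rangle\in\mathcal H_A\otimes\mathcal H_B$ be a unit vector, and let $(a_p)_{p\in\bar{\mathcal I}}\subset\mathcal H_A$ and $(b_q)_{q\in\bar{\mathcal I}}\subset\mathcal H_B$ be unit vectors with $\langle a_{(0,x)},a_{(1,x)}\rangle=0=\langle b_{(0,x)},b_{(1,x)}\rangle$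 for $x=0,1$. Put $v_i=a_{i_A}\otimes b_{i_B}$ for $i\in\mathcal I$ and $v_0=\psi$. Let $\eta_i$ ($i\in\mathcal I$) be nonzero complex numbers, and put $\eta_0=1$. Assume that $X^*_{ij}=\eta_i\overline{\eta_j}\langle v_j,v_i\rangle$ is the unique maximizer of the program, and that: 1. the vectors $\psi$ and $v_i$ ($i\in\mathcal I$) span $\mathcal H_A\otimes\mathcal H_B$; 2. there are a set $\mathcal I_B$ of two Bob labels and, for each $q\in\mathcal I_B$, a set $\mathcal I_{A,q}$ of two Alice labels such that $(p,q)\in\mathcal I$ for all $q\in\mathcal I_B$ and $p\in\mathcal I_{A,q}$; $\{b_q\}_{q\in\mathcal I_B}$ spans $\mathcal H_B$; $\{a_p\}_{p\in\mathcal I_{A,q}}$ spans $\mathcal H_A$ for each $q\in\mathcal I_B$; and the graph on $\mathcal I_B$ that joins $q\ne q'$ when $\langle b_q,b_{q'}\rangle\neq0$ and $\mathcal I_{A,q}\cap\mathcal I_{A,q'}\neq\emptyset$ is connected. Realization. Let $\mathcal H_A',\mathcal H_B'$ be complex Hilbert spaces, $|\psi'\rangle\in\mathcal H_A'\otimes\mathcal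 H_B'$ a unit vector, and $\Pi^A_p$ on $\mathcal H_A'$ and $\Pi^B_q$ on $\mathcal H_B'$ ($p,q\in\bar{\mathcal I}$) orthogonal projections, of arbitrary rank, with $\Pi^A_{(0,x)}+\Pi^A_{(1,x)}=I$ and $\Pi^B_{(0,x)}+\Pi^B_{(1,x)}=I$ for $x=0,1$. Put $\Pi_i=\Pi^A_{i_A}\otimes\Pi^B_{i_B}$ and $\Pi_0=I$. Assume that the matrix $X_{ij}=\langle\psi'|\Pi_j\Pi_i|\psi'\rangle$ is a maximizer of the program, and put $|v_i'\rangle=\eta_i^{-1}\Pi_i|\psi'\rangle$. Then there are Hilbert spaces $\mathcal K_A,\mathcal K_B$, isometries $V_A:\mathcal H_A\otimes\mathcal K_A\to\mathcal H_A'$ and $V_B:\mathcal H_B\otimes\mathcal K_B\to\mathcal H_B'$, and a unit vector $|junk\rangle\in\mathcal K_A\otimes\mathcal K_B$ such that $$(V_A\otimes V_B)(|\psi\rangle\otimes|junk\rangle)=|\psi'\rangle,\qquad (V_A\otimes V_B)(|v_i\rangle\otimes|junk\rangle)=|v_i'\rangle\quad\text{for all } i\in\mathcal I,$$ where the tensor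 factors are reordered as $\mathcal H_A\otimes\mathcal K_A\otimes\mathcal H_B\otimes\mathcal K_B$. -/

import Mathlib

open scoped TensorProduct ComplexOrder

universe u v

noncomputable section

/-! ### The semidefinite program for the weighted Lovász theta number -/

/-- Feasible points of the semidefinite program of the Lovász theta number of a graph `G` on `ι`:
complex positive semidefinite matrices `X` indexed by `{0} ∪ ι` (`none` plays the role of `0`)
with `X₀₀ = 1`, `Xᵢᵢ = X₀ᵢ` for every vertex `i`, and `Xᵢⱼ = 0` for every edge `i ∼ j`. -/
structure ThetaFeasible {ι : Type*} (G : SimpleGraph ι)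
    (X : Matrix (Option ι) (Option ι) ℂ) : Prop where
  posSemidef : X.PosSemidef
  corner : X none none = 1
  diag : ∀ i : ι, X (some i) (some i) = X none (some i)
  edge : ∀ i j : ι, G.Adj i j → X (some i) (some j) = 0

/-- The objective function `∑ᵢ wᵢ Xᵢᵢ`. -/
def thetaObjective {ι : Type*} [Fintype ι] (w : ι → ℝ)
    (X : Matrix (Option ι) (Option ι) ℂ) : ℝ :=
  ∑ i, w i * (X (some i) (some i)).re

/-- `X` is an optimal solution (maximizer) of the semidefinite program. -/
def IsThetaMaximizer {ι : Type*} [Fintype ι] (G : SimpleGraph ι) (w : ι → ℝ)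
    (X : Matrix (Option ι) (Option ι) ℂ) : Prop :=
  ThetaFeasible G X ∧ ∀ Y, ThetaFeasible G Y → thetaObjective w Y ≤ thetaObjective w X

/-- `X` is the unique optimal solution of the semidefinite program. -/
def IsUniqueThetaMaximizer {ι : Type*} [Fintype ι] (G : SimpleGraph ι) (w : ι → ℝ)
    (X : Matrix (Option ι) (Option ι) ℂ) : Prop :=
  IsThetaMaximizer G w X ∧ ∀ Y, IsThetaMaximizer G w Y → Y = X

/-- Given a vector `u₀` and a family `uᵢ`, the matrix with entries `Xᵢⱼ = ⟨uⱼ, uᵢ⟩`. -/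
def vectorMatrix {ι H : Type*} [NormedAddCommGroup H] [InnerProductSpace ℂ H]
    (u₀ : H) (u : ι → H) : Matrix (Option ι) (Option ι) ℂ :=
  Matrix.of fun i j => inner ℂ (j.elim u₀ u) (i.elim u₀ u)

/-! ### Events and exclusivity -/

/-- The outcomes of the two binary measurements of one party: `(k, x)` is outcome `k` of
measurement `x`. -/
abbrev Label := Fin 2 × Fin 2

/-- Two outcomes are different outcomes of the same measurement. -/
def LocallyExclusive (p q : Label) : Prop := p.2 = q.2 ∧ p.1 ≠ q.1

/-- The graph of exclusivity of a finite set of joint events `(i_A, i_B)`: two events are adjacent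
when some party obtains different outcomes of one and the same measurement. -/
def exclusivityGraph (I : Finset (Label × Label)) : SimpleGraph I where
  Adj i j := LocallyExclusive i.1.1 j.1.1 ∨ LocallyExclusive i.1.2 j.1.2
  symm := ⟨fun _ _ h => h.imp (fun h => ⟨h.1.symm, h.2.symm⟩) (fun h => ⟨h.1.symm, h.2.symm⟩)⟩
  loopless := ⟨fun _ h => h.elim (fun h => h.2 rfl) (fun h => h.2 rfl)⟩

/-! ### Conditions on the reference vectors -/

/-- The reference vectors of one party, for two binary measurements: unit vectors, the two vectors
of each measurement being orthogonal. -/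
def IsBinaryPair {H : Type*} [NormedAddCommGroup H] [InnerProductSpace ℂ H]
    (a : Label → H) : Prop :=
  (∀ p, ‖a p‖ = 1) ∧ ∀ x : Fin 2, inner ℂ (a (0, x)) (a (1, x)) = 0

/-- The graph on a set `JB` of indices of the second party: `p` and `q` are joined when
`⟨b_p, b_q⟩ ≠ 0` and the index sets `JA p` and `JA q` of the first party intersect. -/
def linkGraph {LA LB HB : Type*} [DecidableEq LA] [NormedAddCommGroup HB] [InnerProductSpace ℂ HB]
    (b : LB → HB) (JB : Finset LB) (JA : LB → Finset LA) : SimpleGraph JB where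
  Adj p q := p ≠ q ∧ inner ℂ (b p) (b q) ≠ 0 ∧ (JA p ∩ JA q).Nonempty
  symm := ⟨fun p q h => ⟨h.1.symm, fun h0 => h.2.1 (inner_eq_zero_symm.mp h0),
    Finset.inter_comm (JA p) (JA q) ▸ h.2.2⟩⟩
  loopless := ⟨fun _ h => h.1 rfl⟩

/-- There are a set `JB` of `dim HB` indices of the second party and, for each `q ∈ JB`, a set
`JA q` of `dim HA` indices of the first party such that all `(p, q)` with `q ∈ JB`, `p ∈ JA q` are
among the events, `{b_q : q ∈ JB}` spans `HB`, each `{a_p : p ∈ JA q}` spans `HA`, and the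
graph `linkGraph` on `JB` is connected. -/
def HasLinkedSpanningEvents {LA LB HA HB : Type*} [DecidableEq LA]
    [NormedAddCommGroup HA] [InnerProductSpace ℂ HA]
    [NormedAddCommGroup HB] [InnerProductSpace ℂ HB]
    (I : Finset (LA × LB)) (a : LA → HA) (b : LB → HB) : Prop :=
  ∃ (JB : Finset LB) (JA : LB → Finset LA),
    JB.card = Module.finrank ℂ HB ∧
    (∀ q ∈ JB, (JA q).card = Module.finrank ℂ HA) ∧
    (∀ q ∈ JB, ∀ p ∈ JA q, (p, q) ∈ I) ∧
    Submodule.span ℂ (b '' (JB : Set LB)) = ⊤ ∧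
    (∀ q ∈ JB, Submodule.span ℂ (a '' (JA q : Set LA)) = ⊤) ∧
    (linkGraph b JB JA).Connected

/-! ### Tensor products of Hilbert spaces -/

/-- The Hilbert space tensor product: the completion of the algebraic tensor product for the inner
product `⟨x ⊗ y, x' ⊗ y'⟩ = ⟨x, x'⟩⟨y, y'⟩`. -/
def HilbertTensor (E F : Type*) [NormedAddCommGroup E] [InnerProductSpace ℂ E]
    [NormedAddCommGroup F] [InnerProductSpace ℂ F] : Type _ :=
  UniformSpace.Completion (E ⊗[ℂ] F)

section HilbertTensor

variable {E F E' F' K L : Type*} [NormedAddCommGroup E] [InnerProductSpace ℂ E]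
  [NormedAddCommGroup F] [InnerProductSpace ℂ F] [NormedAddCommGroup E'] [InnerProductSpace ℂ E']
  [NormedAddCommGroup F'] [InnerProductSpace ℂ F'] [NormedAddCommGroup K] [InnerProductSpace ℂ K]
  [NormedAddCommGroup L] [InnerProductSpace ℂ L]

instance : NormedAddCommGroup (HilbertTensor E F) :=
  inferInstanceAs (NormedAddCommGroup (UniformSpace.Completion (E ⊗[ℂ] F)))

instance : InnerProductSpace ℂ (HilbertTensor E F) :=
  inferInstanceAs (InnerProductSpace ℂ (UniformSpace.Completion (E ⊗[ℂ] F)))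

instance : CompleteSpace (HilbertTensor E F) :=
  inferInstanceAs (CompleteSpace (UniformSpace.Completion (E ⊗[ℂ] F)))

/-- The inclusion of the algebraic tensor product into the Hilbert space tensor product. -/
def inclTensor (E F : Type*) [NormedAddCommGroup E] [InnerProductSpace ℂ E]
    [NormedAddCommGroup F] [InnerProductSpace ℂ F] : E ⊗[ℂ] F →ₗᵢ[ℂ] HilbertTensor E F :=
  UniformSpace.Completion.toComplₗᵢ (𝕜 := ℂ) (E := E ⊗[ℂ] F)

theorem dense_inclTensor : DenseRange (inclTensor E F) :=
  UniformSpace.Completion.denseRange_coe (α := E ⊗[ℂ] F)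

/-- The operator `x ↦ e ⊗ x`, which adjoins the fixed vector `e` as a left tensor factor. -/
def adjoinVec (e : E) : K →L[ℂ] HilbertTensor E K :=
  (inclTensor E K).toContinuousLinearMap ∘L TensorProduct.mkL ℂ E K e

theorem adjoinVec_apply (e : E) (k : K) : adjoinVec e k = inclTensor E K (e ⊗ₜ k) := rfl

/-- The bounded operator `S ⊗ T` between Hilbert space tensor products: the continuous extension
of `x ⊗ y ↦ S x ⊗ T y`. -/
def tensorOp (S : E →L[ℂ] E') (T : F →L[ℂ] F') : HilbertTensor E F →L[ℂ] HilbertTensor E' F' :=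
  (TensorProduct.mapL S T).completion

theorem tensorOp_incl (S : E →L[ℂ] E') (T : F →L[ℂ] F') (x : E ⊗[ℂ] F) :
    tensorOp S T (inclTensor E F x) = inclTensor E' F' (TensorProduct.mapL S T x) :=
  ContinuousLinearMap.completion_apply_coe _ _

/-- Two bounded operators on a Hilbert space tensor product agree if they agree on pure tensors. -/
theorem hilbertTensor_ext {G : Type*} [NormedAddCommGroup G] [InnerProductSpace ℂ G]
    {S T : HilbertTensor E F →L[ℂ] G}
    (h : ∀ x y, S (inclTensor E F (x ⊗ₜ y)) = T (inclTensor E F (x ⊗ₜ y))) : S = T := by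
  have h1 : ∀ z, S (inclTensor E F z) = T (inclTensor E F z) := by
    intro z
    induction z using TensorProduct.induction_on with
    | zero => simp
    | tmul x y => exact h x y
    | add x y hx hy => simp only [map_add, hx, hy]
  exact ContinuousLinearMap.ext fun z =>
    congrFun (dense_inclTensor.equalizer S.continuous T.continuous (funext h1)) z

theorem tensorOp_pure (S : E →L[ℂ] E') (T : F →L[ℂ] F') (x : E) (y : F) :
    tensorOp S T (inclTensor E F (x ⊗ₜ y)) = inclTensor E' F' (S x ⊗ₜ T y) := by
  rw [tensorOp_incl, TensorProduct.mapL_tmul]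

/-- For `φ ∈ E ⊗ F` and `κ` in the Hilbert space tensor product of `K` and `L`, the vector `φ ⊗ κ`
with its factors grouped party by party, in the tensor product of `E ⊗ K` and `F ⊗ L`. It is linear
in `φ`, and `(e ⊗ f) ⊗ (k ⊗ l)` becomes `(e ⊗ k) ⊗ (f ⊗ l)`. -/
def attach : E ⊗[ℂ] F →ₗ[ℂ]
    (HilbertTensor K L →L[ℂ] HilbertTensor (HilbertTensor E K) (HilbertTensor F L)) :=
  TensorProduct.lift <| LinearMap.mk₂ ℂ
    (fun e f => tensorOp (adjoinVec (K := K) e) (adjoinVec (K := L) f))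
    (fun e e' f => hilbertTensor_ext fun k l => by
      simp only [_root_.add_apply, tensorOp_pure, adjoinVec_apply,
        TensorProduct.add_tmul, map_add])
    (fun c e f => hilbertTensor_ext fun k l => by
      simp only [_root_.smul_apply, tensorOp_pure, adjoinVec_apply,
        ← TensorProduct.smul_tmul', map_smul])
    (fun e f f' => hilbertTensor_ext fun k l => by
      simp only [_root_.add_apply, tensorOp_pure, adjoinVec_apply,
        TensorProduct.add_tmul, TensorProduct.tmul_add, map_add])
    (fun c e f => hilbertTensor_ext fun k l => by
      simp only [_root_.smul_apply, tensorOp_pure, adjoinVec_apply,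
        ← TensorProduct.smul_tmul', TensorProduct.tmul_smul, map_smul])

theorem attach_tmul (e : E) (f : F) (k : K) (l : L) :
    attach (e ⊗ₜ[ℂ] f) (inclTensor K L (k ⊗ₜ l)) =
      inclTensor (HilbertTensor E K) (HilbertTensor F L)
        (inclTensor E K (e ⊗ₜ k) ⊗ₜ inclTensor F L (f ⊗ₜ l)) :=
  tensorOp_pure _ _ _ _

end HilbertTensor

/-- The ideal local system `ℂ²`. -/
abbrev Qubit := EuclideanSpace ℂ (Fin 2)

end

/-! ### Uniqueness in the theta program and perturbations of the maximizer. -/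

section Program

variable {ι H H' : Type*} [NormedAddCommGroup H] [InnerProductSpace ℂ H]
  [NormedAddCommGroup H'] [InnerProductSpace ℂ H']

/-! The realization has the same Gram matrix as the reference system, but a Gram matrix says nothing
about how `Π_i` acts on `Π_j ψ'`. The core of the proof is that optimality forces `Π_i Π_j ψ'` to be
a multiple of `Π_i ψ'`, so that on the normalized vectors `Π_i v'_j = ⟨v_i, v_j⟩ v'_i`, as for rank
one projections.

Three facts give this (`IsUniqueThetaMaximizer.apply_apply_eq_smul`). (1) Every unit vector in the
top eigenspace of `W = ∑ w_i Π_i` yields the unique maximizer, so compressing `Π_j Π_i` to this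
eigenspace gives a scalar. (2) The projection `e` onto the eigenspace is a strong limit of averages
of powers of `W/θ`, which lie in the algebra generated by the local projections; since each party
has two binary measurements, the corner of this algebra at `Π_i` is the centre times `Π_i`. (3) An
operator commuting with all `Π_i` scales the whole Gram matrix of the realization, by uniqueness of
the maximizer. Hence the central elements that represent `Π_i e Π_i` tend to a scalar on `ψ'`, and
so also on every `Π_i Π_j ψ'`.

The action rule then shows that one vector `y = v'_(p,q)` is an eigenvector of local products such
as `Π_p Π_p' Π_p`, with the reference overlap as eigenvalue. Thus `y` lies in a tensor product of
two kernels. On each kernel the two projections of a party span two-dimensional blocks `ℂ² ⊗ K`,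
which gives the local isometries, and `y` itself is the junk state. The embedded reference vectors
and the `v'_i` obey the same action rule and agree at one event; uniqueness makes the
non-orthogonality graph of the events connected, so they agree at all. The state follows because the
`v_i` span. -/

theorem vectorMatrix_posSemidef [Finite ι] (u₀ : H) (u : ι → H) :
    (vectorMatrix u₀ u).PosSemidef :=
  (Matrix.posSemidef_gram ℂ (fun i : Option ι => i.elim u₀ u)).transpose

/-- The quadratic form of a Gram matrix at `x` is `‖∑ x_i v_i‖²`, and `S` enlarges it at most by the
factor `‖S‖²`. -/
theorem vectorMatrix_smul_sub_posSemidef [Finite ι] (u₀ : H) (u : ι → H) (S : H →L[ℂ] H')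
    {C : ℝ} (hC : ‖S‖ ^ 2 ≤ C) :
    ((C : ℂ) • vectorMatrix u₀ u - vectorMatrix (S u₀) (S ∘ u)).PosSemidef := by
  have := Fintype.ofFinite ι
  set v : Option ι → H := fun i => i.elim u₀ u with hv
  have hX : vectorMatrix u₀ u = (Matrix.gram ℂ v).transpose := rfl
  have hZ : vectorMatrix (S u₀) (S ∘ u) = (Matrix.gram ℂ (S ∘ v)).transpose := by
    ext i j
    cases i <;> cases j <;> rfl
  have hherm : ((C : ℂ) • Matrix.gram ℂ v - Matrix.gram ℂ (S ∘ v)).IsHermitian := by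
    refine Matrix.IsHermitian.sub ?_ (Matrix.isHermitian_gram ℂ _)
    rw [Matrix.IsHermitian, Matrix.conjTranspose_smul, (Matrix.isHermitian_gram ℂ v).eq]
    simp
  have key : ((C : ℂ) • Matrix.gram ℂ v - Matrix.gram ℂ (S ∘ v)).PosSemidef := by
    refine Matrix.PosSemidef.of_dotProduct_mulVec_nonneg hherm fun x => ?_
    rw [Matrix.sub_mulVec, Matrix.smul_mulVec, dotProduct_sub, dotProduct_smul,
      Matrix.star_dotProduct_gram_mulVec, Matrix.star_dotProduct_gram_mulVec]
    have h1 : ∑ i, x i • (S ∘ v) i = S (∑ i, x i • v i) := by simp [map_sum]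
    rw [h1, inner_self_eq_norm_sq_to_K, inner_self_eq_norm_sq_to_K, smul_eq_mul]
    have h2 : ‖S (∑ i, x i • v i)‖ ^ 2 ≤ C * ‖∑ i, x i • v i‖ ^ 2 := by
      calc ‖S (∑ i, x i • v i)‖ ^ 2 ≤ (‖S‖ * ‖∑ i, x i • v i‖) ^ 2 := by
            gcongr; exact S.le_opNorm _
        _ = ‖S‖ ^ 2 * ‖∑ i, x i • v i‖ ^ 2 := by ring
        _ ≤ _ := by gcongr
    rw [sub_nonneg]
    simp only [Complex.coe_algebraMap]
    exact_mod_cast h2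
  have := key.transpose
  rwa [Matrix.transpose_sub, Matrix.transpose_smul, ← hX, ← hZ] at this

theorem thetaObjective_add [Fintype ι] (w : ι → ℝ) (X Y : Matrix (Option ι) (Option ι) ℂ) :
    thetaObjective w (X + Y) = thetaObjective w X + thetaObjective w Y := by
  simp [thetaObjective, mul_add, Finset.sum_add_distrib]

theorem thetaObjective_smul [Fintype ι] (w : ι → ℝ) (c : ℝ)
    (X : Matrix (Option ι) (Option ι) ℂ) :
    thetaObjective w ((c : ℂ) • X) = c * thetaObjective w X := by
  simp only [thetaObjective, Finset.mul_sum]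
  refine Finset.sum_congr rfl fun i _ => ?_
  simp
  ring

/-- A positive semidefinite matrix that satisfies the homogeneous constraints and is dominated by
the unique maximizer is a multiple of it. -/
theorem IsUniqueThetaMaximizer.eq_smul_of_sub_posSemidef [Fintype ι] {G : SimpleGraph ι}
    {w : ι → ℝ} {X Z : Matrix (Option ι) (Option ι) ℂ} (hX : IsUniqueThetaMaximizer G w X)
    (hZ : Z.PosSemidef) {C t : ℝ} (hC : 0 < C) (hXZ : ((C : ℂ) • X - Z).PosSemidef)
    (ht : Z none none = t)
    (hdiag : ∀ i, Z (some i) (some i) = Z none (some i))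
    (hedge : ∀ i j, G.Adj i j → Z (some i) (some j) = 0) :
    Z = (t : ℂ) • X := by
  have hXf := hX.1.1
  have ht0 : 0 ≤ t := by
    have := hZ.diag_nonneg (i := none)
    rw [ht] at this
    exact_mod_cast this
  have htC : t ≤ C := by
    have := hXZ.diag_nonneg (i := none)
    simp only [Matrix.sub_apply, Matrix.smul_apply, hXf.corner, ht, smul_eq_mul, mul_one,
      sub_nonneg] at this
    exact_mod_cast this
  -- With this step size, `X` can be moved along `Z - tX` in both directions: the two endpoints are
  -- `(1 - δt)X + δZ` and `δtX + δ(CX - Z)`. The objective is therefore stationary in this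
  -- direction, and uniqueness excludes any movement.
  set δ : ℝ := C⁻¹ with hδ
  have hδ0 : 0 < δ := inv_pos.2 hC
  have hδt : δ * t ≤ 1 := by
    rw [hδ, inv_mul_le_iff₀ hC]; simpa using htC
  have feas : ∀ s : ℝ, (X + (s : ℂ) • (Z - (t : ℂ) • X)).PosSemidef →
      ThetaFeasible G (X + (s : ℂ) • (Z - (t : ℂ) • X)) := fun s hs =>
    { posSemidef := hs
      corner := by simp [hXf.corner, ht]
      diag := fun i => by simp [hXf.diag i, hdiag i]
      edge := fun i j h => by simp [hXf.edge i j h, hedge i j h] }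
  have hp : (X + (δ : ℂ) • (Z - (t : ℂ) • X)).PosSemidef := by
    have e : X + (δ : ℂ) • (Z - (t : ℂ) • X)
        = ((1 - δ * t : ℝ) : ℂ) • X + (δ : ℂ) • Z := by
      push_cast; module
    rw [e]
    refine (hXf.posSemidef.smul ?_).add (hZ.smul ?_)
    · exact_mod_cast sub_nonneg.2 hδt
    · exact_mod_cast hδ0.le
  have hm : (X + ((-δ : ℝ) : ℂ) • (Z - (t : ℂ) • X)).PosSemidef := by
    have hcancel : (δ : ℂ) * C = 1 := by
      rw [hδ]; push_cast; exact inv_mul_cancel₀ (by exact_mod_cast hC.ne')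
    have e : X + ((-δ : ℝ) : ℂ) • (Z - (t : ℂ) • X)
        = ((δ * t : ℝ) : ℂ) • X + (δ : ℂ) • ((C : ℂ) • X - Z) := by
      rw [smul_sub (δ : ℂ), smul_smul (δ : ℂ), hcancel]
      push_cast; module
    rw [e]
    refine (hXf.posSemidef.smul ?_).add (hXZ.smul ?_)
    · exact_mod_cast (mul_nonneg hδ0.le ht0)
    · exact_mod_cast hδ0.le
  have h1 := hX.1.2 _ (feas _ hp)
  have h2 := hX.1.2 _ (feas _ hm)
  rw [thetaObjective_add, thetaObjective_smul] at h1 h2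
  have h0 : thetaObjective w (Z - (t : ℂ) • X) = 0 := by
    have h1' : thetaObjective w (Z - (t : ℂ) • X) ≤ 0 := by
      by_contra! h
      have := mul_pos hδ0 h
      linarith
    have h2' : 0 ≤ thetaObjective w (Z - (t : ℂ) • X) := by
      by_contra! h
      have := mul_pos hδ0 (neg_pos.2 h)
      linarith
    exact le_antisymm h1' h2'
  have hmax : IsThetaMaximizer G w (X + (δ : ℂ) • (Z - (t : ℂ) • X)) := by
    refine ⟨feas _ hp, fun Y hY => (hX.1.2 Y hY).trans ?_⟩
    rw [thetaObjective_add, thetaObjective_smul, h0, mul_zero, add_zero]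
  have hfin := hX.2 _ hmax
  rw [add_eq_left, smul_eq_zero, sub_eq_zero] at hfin
  exact hfin.resolve_left (by exact_mod_cast hδ0.ne')

/-- If a bounded operator maps the vectors of the unique maximizer to vectors that satisfy the
homogeneous constraints, then it scales their Gram matrix. -/
theorem IsUniqueThetaMaximizer.vectorMatrix_map [Fintype ι] {G : SimpleGraph ι}
    {w : ι → ℝ} {u₀ : H} {u : ι → H}
    (hX : IsUniqueThetaMaximizer G w (vectorMatrix u₀ u)) (S : H →L[ℂ] H')
    (hdiag : ∀ i, inner ℂ (S (u i)) (S (u i)) = inner ℂ (S (u i)) (S u₀))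
    (hedge : ∀ i j, G.Adj i j → inner ℂ (S (u j)) (S (u i)) = 0) :
    vectorMatrix (S u₀) (S ∘ u) = ((‖S u₀‖ ^ 2 : ℝ) : ℂ) • vectorMatrix u₀ u := by
  refine hX.eq_smul_of_sub_posSemidef (vectorMatrix_posSemidef _ _)
    -- The summand `1` keeps the constant positive when `S = 0`.
    (C := ‖S‖ ^ 2 + 1) (by positivity)
    (vectorMatrix_smul_sub_posSemidef u₀ u S (by linarith)) ?_ hdiag hedge
  simp [vectorMatrix, inner_self_eq_norm_sq_to_K]

end Program

/-! ### Corners of the algebra generated by two commuting pairs of idempotents. -/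

section Corner

variable {R : Type*} [Ring R] [Algebra ℂ R]

/-- `m` belongs to the algebra generated by two pairs of idempotents; the element `z` produced is
central in that algebra. -/
theorem exists_central_mul_of_mem_adjoin {p p' q q' : R} (hp : p * p = p) (hp' : p' * p' = p')
    (hq : q * q = q) (hq' : q' * q' = q') (h1 : Commute p q) (h2 : Commute p q')
    (h3 : Commute p' q) (h4 : Commute p' q') {m : R}
    (hm : m ∈ Algebra.adjoin ℂ ({p, p', q, q'} : Set R)) :
    ∃ z ∈ Subalgebra.centralizer ℂ ({p, p', q, q'} : Set R),
      (p * q) * m * (p * q) = z * (p * q) := by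
  set Z := Subalgebra.centralizer ℂ ({p, p', q, q'} : Set R) with hZ
  -- The element `1 - (p - p')²` commutes with both idempotents and satisfies `p p' p = (1 - (p -
  -- p')²) p`, so every alternating word collapses up to central factors.
  have comp : ∀ {p p' q q' : R}, p * p = p → p' * p' = p' → Commute p q → Commute p q' →
      Commute p' q → Commute p' q' →
      1 - (p - p') ^ 2 ∈ Subalgebra.centralizer ℂ ({p, p', q, q'} : Set R) := by
    intro p p' q q' hp hp' h1 h2 h3 h4
    rw [Subalgebra.mem_centralizer_iff]
    have e : 1 - (p - p') ^ 2 = 1 - p - p' + p * p' + p' * p := by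
      rw [sq, sub_mul, mul_sub, mul_sub, hp, hp']; abel
    have c1 : Commute q (p - p') := (h1.symm.sub_right h3.symm)
    have c2 : Commute q' (p - p') := (h2.symm.sub_right h4.symm)
    rintro g (rfl | rfl | rfl | rfl)
    · rw [e]
      simp only [mul_add, mul_sub, add_mul, sub_mul, mul_one, one_mul, ← mul_assoc, hp]
      simp only [mul_assoc, hp]; abel
    · rw [e]
      simp only [mul_add, mul_sub, add_mul, sub_mul, mul_one, one_mul, ← mul_assoc, hp']
      simp only [mul_assoc, hp']; abel
    · exact ((Commute.one_right _).sub_right (c1.pow_right 2)).eq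
    · exact ((Commute.one_right _).sub_right (c2.pow_right 2)).eq
  have tab : ∀ {p p' : R}, p * p = p → p' * p' = p' → 1 - (p - p') ^ 2 ∈ Z →
      ∀ r ∈ ({p, p'} : Set R), ∀ x ∈ ({p, p'} : Set R), ∃ z ∈ Z, r * x * p = z * (r * p) := by
    intro p p' hp hp' hd r hr x hx
    rcases hr with rfl | rfl <;> rcases hx with rfl | rfl
    · exact ⟨1, Z.one_mem, by simp [hp]⟩
    · refine ⟨_, hd, ?_⟩
      have e : 1 - (r - x) ^ 2 = 1 - r - x + r * x + x * r := by
        rw [sq, sub_mul, mul_sub, mul_sub, hp, hp']; abel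
      rw [e, hp]
      simp only [add_mul, sub_mul, mul_assoc, hp, one_mul]; abel
    · exact ⟨1, Z.one_mem, by simp [mul_assoc, hp]⟩
    · exact ⟨1, Z.one_mem, by simp [hp']⟩
  have hdA : 1 - (p - p') ^ 2 ∈ Z := comp hp hp' h1 h2 h3 h4
  have hdB : 1 - (q - q') ^ 2 ∈ Z := by
    have := comp hq hq' h1.symm h3.symm h2.symm h4.symm
    have e : ({q, q', p, p'} : Set R) = {p, p', q, q'} := by
      ext; simp only [Set.mem_insert_iff, Set.mem_singleton_iff]; tauto
    rwa [e] at this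
  have hcomm : ∀ r ∈ ({p, p'} : Set R), ∀ s ∈ ({q, q'} : Set R), Commute r s := by
    rintro r (rfl | rfl) s (rfl | rfl) <;> assumption
  have zc : ∀ z ∈ Z, ∀ g ∈ ({p, p', q, q'} : Set R), g * z = z * g := fun z hz g hg =>
    Subalgebra.mem_centralizer_iff ℂ |>.1 hz g hg
  have hA : ∀ r ∈ ({p, p'} : Set R), r ∈ ({p, p', q, q'} : Set R) := by
    rintro r (rfl | rfl) <;> simp
  have hB : ∀ r ∈ ({q, q'} : Set R), r ∈ ({p, p', q, q'} : Set R) := by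
    rintro r (rfl | rfl) <;> simp
  -- All left factors `r`, `s` are allowed, and not only `p`, `q`, because left multiplication by a
  -- generator replaces one of them in the induction.
  let good : R → Prop := fun n => ∀ r ∈ ({p, p'} : Set R), ∀ s ∈ ({q, q'} : Set R),
    ∃ z ∈ Z, r * s * n * (p * q) = z * (r * s * (p * q))
  have good_add : ∀ a b, good a → good b → good (a + b) := by
    intro a b ha hb r hr s hs
    obtain ⟨z, hz, e⟩ := ha r hr s hs
    obtain ⟨z', hz', e'⟩ := hb r hr s hs
    exact ⟨z + z', Z.add_mem hz hz', by rw [mul_add, add_mul, e, e', add_mul]⟩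
  have good_mul : ∀ m ∈ Algebra.adjoin ℂ ({p, p', q, q'} : Set R), ∀ n, good n →
      good (m * n) := by
    intro m hm
    induction hm using Algebra.adjoin_induction with
    | mem x hx =>
      intro n hn r hr s hs
      have hx' : x ∈ ({p, p'} : Set R) ∨ x ∈ ({q, q'} : Set R) := by
        simpa only [Set.mem_insert_iff, Set.mem_singleton_iff, or_assoc] using hx
      rcases hx' with hx' | hx'
      · obtain ⟨z, hz, e⟩ := hn x hx' s hs
        obtain ⟨y, hy, f⟩ := tab hp hp' hdA r hr x hx'
        refine ⟨z * y, Z.mul_mem hz hy, ?_⟩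
        have c : s * x = x * s := (hcomm x hx' s hs).eq.symm
        have c' : s * p = p * s := (hcomm p (by simp) s hs).eq.symm
        calc r * s * (x * n) * (p * q) = r * (x * s * n * (p * q)) := by
              rw [← c]; simp only [mul_assoc]
          _ = z * (r * x * (s * p) * q) := by
              rw [e, ← mul_assoc r z, zc z hz r (hA r hr)]; simp only [mul_assoc]
          _ = z * (r * x * p * s * q) := by rw [c']; simp only [mul_assoc]
          _ = z * y * (r * (p * s) * q) := by rw [f]; simp only [mul_assoc]
          _ = _ := by rw [← c']; simp only [mul_assoc]
      · obtain ⟨z, hz, e⟩ := hn r hr x hx'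
        obtain ⟨y, hy, f⟩ := tab hq hq' hdB s hs x hx'
        refine ⟨z * y, Z.mul_mem hz hy, ?_⟩
        have c : r * s = s * r := (hcomm r hr s hs).eq
        have c1 : r * x = x * r := (hcomm r hr x hx').eq
        have hpq : p * q = q * p := h1.eq
        calc r * s * (x * n) * (p * q) = s * (r * x * n * (p * q)) := by
              rw [c]; simp only [mul_assoc]
          _ = z * (s * (r * x) * (p * q)) := by
              rw [e, ← mul_assoc s z, zc z hz s (hB s hs)]; simp only [mul_assoc]
          _ = z * (s * x * (r * q) * p) := by rw [c1, hpq]; simp only [mul_assoc]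
          _ = z * (s * x * q * r * p) := by
              rw [(hcomm r hr q (by simp)).eq]; simp only [mul_assoc]
          _ = z * y * (s * (q * r) * p) := by rw [f]; simp only [mul_assoc]
          _ = z * y * (s * (r * q) * p) := by rw [(hcomm r hr q (by simp)).eq]
          _ = z * y * (s * r * (q * p)) := by simp only [mul_assoc]
          _ = _ := by rw [← hpq, ← c]
    | algebraMap c =>
      intro n hn r hr s hs
      obtain ⟨z, hz, e⟩ := hn r hr s hs
      refine ⟨c • z, Z.smul_mem hz c, ?_⟩
      rw [← Algebra.smul_def, mul_smul_comm, smul_mul_assoc, e, smul_mul_assoc]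
    | add a b _ _ iha ihb =>
      intro n hn
      rw [add_mul]; exact good_add _ _ (iha n hn) (ihb n hn)
    | mul a b _ _ iha ihb =>
      intro n hn
      rw [mul_assoc]; exact iha _ (ihb n hn)
  have good_one : good 1 := fun r hr s hs => ⟨1, Z.one_mem, by simp⟩
  obtain ⟨z, hz, e⟩ := good_mul m hm 1 good_one p (by simp) q (by simp)
  refine ⟨z, hz, ?_⟩
  have hpp : p * q * (p * q) = p * q := by
    rw [mul_assoc, ← mul_assoc q, ← h1.eq, mul_assoc, hq, ← mul_assoc, hp]
  rwa [mul_one, hpp] at e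

end Corner

/-! ### The weighted sum of projections and its top eigenspace. -/

section Core

open Filter Topology

variable {ι H : Type*} [Fintype ι] [NormedAddCommGroup H] [InnerProductSpace ℂ H]
  [CompleteSpace H]

theorem IsStarProjection.inner_apply_self {P : H →L[ℂ] H} (hP : IsStarProjection P) (x : H) :
    inner ℂ (P x) (P x) = inner ℂ (P x) x := by
  have h := ContinuousLinearMap.isSelfAdjoint_iff_isSymmetric.1 hP.isSelfAdjoint (P x) x
  have h2 : P (P x) = P x := congrArg (· x) hP.isIdempotentElem
  simp only [ContinuousLinearMap.coe_coe, h2] at h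
  exact h.symm

theorem IsStarProjection.inner_apply_left {P : H →L[ℂ] H} (hP : IsStarProjection P) (x y : H) :
    inner ℂ (P x) y = inner ℂ x (P y) :=
  ContinuousLinearMap.isSelfAdjoint_iff_isSymmetric.1 hP.isSelfAdjoint x y

variable {G : SimpleGraph ι} {w : ι → ℝ} {P : ι → H →L[ℂ] H}

theorem thetaFeasible_of_isStarProjection (hP : ∀ i, IsStarProjection (P i))
    (hedge : ∀ i j, G.Adj i j → P i * P j = 0) {φ : H} (hφ : ‖φ‖ = 1) :
    ThetaFeasible G (vectorMatrix φ fun i => P i φ) where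
  posSemidef := vectorMatrix_posSemidef _ _
  corner := by simp [vectorMatrix, inner_self_eq_norm_sq_to_K, hφ]
  diag i := (hP i).inner_apply_self φ
  edge i j h := by
    change inner ℂ (P j φ) (P i φ) = 0
    rw [(hP j).inner_apply_left, ← mul_apply_eq_comp, hedge j i h.symm]
    simp

theorem thetaObjective_vectorMatrix (w : ι → ℝ) (hP : ∀ i, IsStarProjection (P i)) (φ : H) :
    thetaObjective w (vectorMatrix φ fun i => P i φ)
      = (inner ℂ φ ((∑ i, (w i : ℂ) • P i) φ)).re := by
  simp only [thetaObjective, _root_.sum_apply, inner_sum, Complex.re_sum]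
  refine Finset.sum_congr rfl fun i _ => ?_
  change w i * (inner ℂ (P i φ) (P i φ)).re = _
  rw [(hP i).inner_apply_self, (hP i).inner_apply_left]
  simp

/-- Every normalized vector is itself feasible through the same projections, so the optimal value
bounds the quadratic form of the weighted sum. -/
theorem thetaObjective_vectorMatrix_le {ξ : H}
    (hξ : IsThetaMaximizer G w (vectorMatrix ξ fun i => P i ξ))
    (hP : ∀ i, IsStarProjection (P i)) (hedge : ∀ i j, G.Adj i j → P i * P j = 0) (φ : H) :
    (inner ℂ φ ((∑ i, (w i : ℂ) • P i) φ)).re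
      ≤ thetaObjective w (vectorMatrix ξ fun i => P i ξ) * ‖φ‖ ^ 2 := by
  rcases eq_or_ne φ 0 with rfl | hφ
  · simp
  have hn : ‖φ‖ ≠ 0 := norm_ne_zero_iff.2 hφ
  have h1 : ‖((‖φ‖⁻¹ : ℝ) : ℂ) • φ‖ = 1 := by
    rw [norm_smul]; simp [hn]
  have h := hξ.2 _ (thetaFeasible_of_isStarProjection hP hedge h1)
  rw [thetaObjective_vectorMatrix w hP, map_smul, inner_smul_left, inner_smul_right,
    Complex.conj_ofReal, Complex.re_ofReal_mul, Complex.re_ofReal_mul] at h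
  have hpos : 0 < ‖φ‖ ^ 2 := by positivity
  rw [← div_le_iff₀ hpos]
  calc _ = ‖φ‖⁻¹ * (‖φ‖⁻¹ * (inner ℂ φ ((∑ i, (w i : ℂ) • P i) φ)).re) := by
        field_simp
    _ ≤ _ := h

theorem sum_smul_isStarProjection_nonneg (hw : ∀ i, 0 ≤ w i)
    (hP : ∀ i, IsStarProjection (P i)) : 0 ≤ ∑ i, (w i : ℂ) • P i := by
  refine Finset.sum_nonneg fun i _ => ?_
  rw [ContinuousLinearMap.nonneg_iff_isPositive]
  exact (ContinuousLinearMap.IsPositive.of_isStarProjection (hP i)).smul_of_nonneg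
    (by exact_mod_cast hw i)

/-- The weighted sum of the projections, divided by the optimal value, is a contraction. -/
theorem norm_smul_sum_le_one {ξ : H}
    (hξ : IsThetaMaximizer G w (vectorMatrix ξ fun i => P i ξ)) (hw : ∀ i, 0 ≤ w i)
    (hP : ∀ i, IsStarProjection (P i)) (hedge : ∀ i j, G.Adj i j → P i * P j = 0)
    (hpos : 0 < thetaObjective w (vectorMatrix ξ fun i => P i ξ)) :
    ‖((thetaObjective w (vectorMatrix ξ fun i => P i ξ))⁻¹ : ℂ) • ∑ i, (w i : ℂ) • P i‖ ≤ 1 := by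
  set θ := thetaObjective w (vectorMatrix ξ fun i => P i ξ) with hθ
  set W := ∑ i, (w i : ℂ) • P i with hW
  have hW0 : W.IsPositive := by
    rw [← ContinuousLinearMap.nonneg_iff_isPositive]
    exact sum_smul_isStarProjection_nonneg hw hP
  have hf : ((θ : ℂ)⁻¹ • W).IsPositive :=
    hW0.smul_of_nonneg (by exact_mod_cast (inv_pos.2 hpos).le)
  rw [CStarAlgebra.norm_le_one_iff_of_nonneg _
    ((ContinuousLinearMap.nonneg_iff_isPositive _).2 hf), ContinuousLinearMap.le_def,
    ContinuousLinearMap.isPositive_def]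
  refine ⟨ContinuousLinearMap.isPositive_one.isSymmetric.sub hf.isSymmetric, fun x => ?_⟩
  have h := thetaObjective_vectorMatrix_le hξ hP hedge x
  rw [← hW, ← hθ] at h
  have e : (1 - (θ : ℂ)⁻¹ • W).reApplyInnerSelf x = ‖x‖ ^ 2 - θ⁻¹ * (inner ℂ x (W x)).re := by
    rw [ContinuousLinearMap.reApplyInnerSelf_apply, ← inner_conj_symm, RCLike.conj_re]
    have e1 : (1 - (θ : ℂ)⁻¹ • W) x = x - ((θ⁻¹ : ℝ) : ℂ) • W x := by simp
    rw [e1, inner_sub_right, inner_smul_right, map_sub, inner_self_eq_norm_sq]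
    simp
  rw [e, sub_nonneg, inv_mul_le_iff₀ hpos]
  exact h

/-- In an optimal realization, the state is an eigenvector of the weighted sum of the
projections. -/
theorem IsThetaMaximizer.smul_sum_apply {ξ : H}
    (hξ : IsThetaMaximizer G w (vectorMatrix ξ fun i => P i ξ)) (hw : ∀ i, 0 ≤ w i)
    (hP : ∀ i, IsStarProjection (P i)) (hedge : ∀ i j, G.Adj i j → P i * P j = 0)
    (hn : ‖ξ‖ = 1) (hpos : 0 < thetaObjective w (vectorMatrix ξ fun i => P i ξ)) :
    (((thetaObjective w (vectorMatrix ξ fun i => P i ξ))⁻¹ : ℂ) • ∑ i, (w i : ℂ) • P i) ξ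
      = ξ := by
  have hc := norm_smul_sum_le_one hξ hw hP hedge hpos
  have hobj := thetaObjective_vectorMatrix w hP ξ
  set θ := thetaObjective w (vectorMatrix ξ fun i => P i ξ) with hθ
  set W := ∑ i, (w i : ℂ) • P i with hW
  -- Equality case of Cauchy–Schwarz for a contraction whose expectation in the unit vector `ξ` is
  -- `1`.
  refine eq_of_norm_le_re_inner_eq_norm_sq (𝕜 := ℂ) ?_ ?_
  · simpa using ContinuousLinearMap.le_of_opNorm_le _ hc ξ
  · have e1 : ((θ : ℂ)⁻¹ • W) ξ = ((θ⁻¹ : ℝ) : ℂ) • W ξ := by simp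
    rw [e1, inner_smul_left, Complex.conj_ofReal, RCLike.re_to_complex, Complex.re_ofReal_mul,
      ← inner_conj_symm, Complex.conj_re, ← hobj, hn, inv_mul_cancel₀ hpos.ne']
    norm_num

/-- All unit vectors of the top eigenspace give the unique maximizer; in polarized form, the
compression of `P j * P i` to the eigenspace is a scalar. -/
theorem IsUniqueThetaMaximizer.starProjection_mul_mul {ξ : H}
    (hξ : IsUniqueThetaMaximizer G w (vectorMatrix ξ fun i => P i ξ))
    (hP : ∀ i, IsStarProjection (P i)) (hedge : ∀ i j, G.Adj i j → P i * P j = 0)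
    (hpos : 0 < thetaObjective w (vectorMatrix ξ fun i => P i ξ))
    (K : Submodule ℂ H) [K.HasOrthogonalProjection]
    (hK : ∀ φ ∈ K, (((thetaObjective w (vectorMatrix ξ fun i => P i ξ))⁻¹ : ℂ)
      • ∑ i, (w i : ℂ) • P i) φ = φ) (i j : ι) (x : H) :
    K.starProjection (P j (P i (K.starProjection x)))
      = vectorMatrix ξ (fun i => P i ξ) (some i) (some j) • K.starProjection x := by
  set X := vectorMatrix ξ (fun i => P i ξ) with hX
  set θ := thetaObjective w X with hθ
  have key : ∀ φ ∈ K, inner ℂ (P j φ) (P i φ) = X (some i) (some j) * (‖φ‖ : ℂ) ^ 2 := by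
    intro φ hφ
    rcases eq_or_ne φ 0 with rfl | h0
    · simp
    have hn : ‖φ‖ ≠ 0 := norm_ne_zero_iff.2 h0
    set χ := ((‖φ‖⁻¹ : ℝ) : ℂ) • φ with hχ
    have h1 : ‖χ‖ = 1 := by rw [hχ, norm_smul]; simp [hn]
    have hobj : thetaObjective w (vectorMatrix χ fun i => P i χ) = θ := by
      have hfix := hK χ (K.smul_mem _ hφ)
      have hW : (∑ i, (w i : ℂ) • P i) χ = (θ : ℂ) • χ := by
        conv_rhs => rw [← hfix]
        rw [_root_.smul_apply, smul_smul, mul_inv_cancel₀ (by exact_mod_cast hpos.ne'), one_smul]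
      rw [thetaObjective_vectorMatrix w hP, hW, inner_smul_right, Complex.re_ofReal_mul,
        inner_self_eq_norm_sq_to_K, h1]
      simp
    have hmax : IsThetaMaximizer G w (vectorMatrix χ fun i => P i χ) :=
      ⟨thetaFeasible_of_isStarProjection hP hedge h1, fun Y hY => by
        rw [hobj]; exact hξ.1.2 Y hY⟩
    have e := congrFun (congrFun (hξ.2 _ hmax) (some i)) (some j)
    change inner ℂ (P j χ) (P i χ) = X (some i) (some j) at e
    rw [← e, hχ, map_smul, map_smul, inner_smul_left, inner_smul_right, Complex.conj_ofReal]
    have hn' : (‖φ‖ : ℂ) ≠ 0 := by exact_mod_cast hn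
    push_cast
    field_simp
  have hext : (K.starProjection.comp (P j * P i)).comp K.starProjection
      = X (some i) (some j) • K.starProjection := by
    apply ContinuousLinearMap.coe_inj.1
    -- Over `ℂ` an operator is determined by its quadratic form, so `key` on single vectors
    -- suffices.
    refine (ext_inner_map _ _).1 fun y => ?_
    rw [← inner_conj_symm, ← inner_conj_symm (_ : H) y]
    congr 1
    simp only [ContinuousLinearMap.coe_coe, ContinuousLinearMap.comp_apply,
      _root_.smul_apply, inner_smul_right, mul_apply_eq_comp]
    rw [← K.inner_starProjection_left_eq_right, ← (hP j).inner_apply_left,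
      key _ (K.starProjection_apply_mem y)]
    congr 1
    rw [← K.starProjection_eq_self_iff.2 (K.starProjection_apply_mem y),
      ← K.inner_starProjection_left_eq_right, inner_self_eq_norm_sq_to_K,
      K.starProjection_eq_self_iff.2 (K.starProjection_apply_mem y)]
    simp
  exact congrArg (· x) hext

end Core

/-! ### Optimality determines the action of the projections. -/

section Rigidity

open Filter Topology

variable {ι H : Type*} [Fintype ι] [NormedAddCommGroup H] [InnerProductSpace ℂ H]
  [CompleteSpace H] {G : SimpleGraph ι} {w : ι → ℝ} {P : ι → H →L[ℂ] H}

/-- Since `S` commutes with the projections, `S ξ` with the vectors `P i (S ξ)` satisfies the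
homogeneous constraints, so its Gram matrix is a multiple of the maximizer. -/
theorem norm_sq_apply_of_commute {ξ : H}
    (hξ : IsUniqueThetaMaximizer G w (vectorMatrix ξ fun i => P i ξ))
    (hP : ∀ i, IsStarProjection (P i)) (hedge : ∀ i j, G.Adj i j → P i * P j = 0)
    {S : H →L[ℂ] H} (hS : ∀ i, S * P i = P i * S) (i : ι) :
    ‖S (P i ξ)‖ ^ 2 = ‖S ξ‖ ^ 2 * ‖P i ξ‖ ^ 2 := by
  have hS' : ∀ i x, S (P i x) = P i (S x) := fun i x => congrArg (· x) (hS i)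
  have h := hξ.vectorMatrix_map S
    (fun i => by rw [hS']; exact (hP i).inner_apply_self _)
    (fun i j hij => by
      rw [hS', hS', (hP j).inner_apply_left, ← mul_apply_eq_comp, hedge j i hij.symm]
      simp)
  have e : inner ℂ (S (P i ξ)) (S (P i ξ))
      = ((‖S ξ‖ ^ 2 : ℝ) : ℂ) * inner ℂ (P i ξ) (P i ξ) :=
    congrFun (congrFun h (some i)) (some i)
  rw [inner_self_eq_norm_sq_to_K, inner_self_eq_norm_sq_to_K] at e
  simp only [Complex.coe_algebraMap] at e
  exact_mod_cast e

/-- In an optimal realization in an algebra all of whose corners at the projections are central,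
the projections act on the vectors `P j ξ` as the reference projections do. -/
theorem IsUniqueThetaMaximizer.apply_apply_eq_smul {ξ : H}
    (hξ : IsUniqueThetaMaximizer G w (vectorMatrix ξ fun i => P i ξ)) (hw : ∀ i, 0 ≤ w i)
    (hP : ∀ i, IsStarProjection (P i)) (hedge : ∀ i j, G.Adj i j → P i * P j = 0)
    (hn : ‖ξ‖ = 1) (hpos : 0 < thetaObjective w (vectorMatrix ξ fun i => P i ξ))
    (M : Subalgebra ℂ (H →L[ℂ] H)) (hM : ∀ i, P i ∈ M)
    (hcorner : ∀ i, ∀ m ∈ M, ∃ z : H →L[ℂ] H, (∀ n ∈ M, z * n = n * z) ∧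
      P i * m * P i = z * P i)
    {i : ι} (hi : P i ξ ≠ 0) (j : ι) :
    P i (P j ξ) = (inner ℂ (P i ξ) (P j ξ) / inner ℂ (P i ξ) (P i ξ)) • P i ξ := by
  set θ := thetaObjective w (vectorMatrix ξ fun i => P i ξ) with hθ
  set f : H →L[ℂ] H := (θ : ℂ)⁻¹ • ∑ i, (w i : ℂ) • P i with hf
  have hfnorm : ‖f‖ ≤ 1 := norm_smul_sum_le_one hξ.1 hw hP hedge hpos
  have hfξ : f ξ = ξ := hξ.1.smul_sum_apply hw hP hedge hn hpos
  have hfM : f ∈ M := M.smul_mem (M.sum_mem fun i _ => M.smul_mem (hM i) _) _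
  set K : Submodule ℂ H := f.eqLocus (1 : H →L[ℂ] H) with hK
  have hξK : ξ ∈ K := hfξ
  set e := K.starProjection with he
  have heξ : e ξ = ξ := K.starProjection_eq_self_iff.2 hξK
  have hcomp := hξ.starProjection_mul_mul hP hedge hpos K (fun φ hφ => hφ)
  -- By the mean ergodic theorem for the contraction `f`, these averages converge strongly to the
  -- projection onto its fixed vectors, while each of them stays in the algebra `M`.
  set A : ℕ → H →L[ℂ] H := fun n => (n : ℂ)⁻¹ • ∑ k ∈ Finset.range n, f ^ k with hA
  have hAM : ∀ n, A n ∈ M := fun n => M.smul_mem (M.sum_mem fun k _ => M.pow_mem hfM k) _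
  have hAlim : ∀ x, Tendsto (fun n => A n x) atTop (𝓝 (e x)) := by
    intro x
    have h := f.tendsto_birkhoffAverage_orthogonalProjection hfnorm x
    refine h.congr fun n => ?_
    simp [birkhoffAverage, birkhoffSum, hA, _root_.sum_apply]
  choose z hz hzP using fun n => hcorner i (A n) (hAM n)
  set s : ℂ := inner ℂ (P i ξ) (P i ξ) with hs
  have hPP : ∀ x, P i (P i x) = P i x := fun x => congrArg (· x) (hP i).isIdempotentElem
  have hzx : ∀ n x, z n (P i x) = P i (A n (P i x)) := fun n x =>
    (congrArg (· x) (hzP n)).symm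
  have hlim : ∀ x, Tendsto (fun n => z n (P i x)) atTop (𝓝 (P i (e (P i x)))) := fun x => by
    simp only [hzx]
    exact ((P i).continuous.tendsto _).comp (hAlim _)
  have hee : ∀ k, e (P i (P k ξ)) = inner ℂ (P i ξ) (P k ξ) • ξ := by
    intro k
    have := hcomp k i ξ
    rwa [← he, heξ] at this
  -- Convergence is visible only on `P i ξ`; it passes to `ξ` because `z n - s` commutes with all
  -- projections, so its norms at `ξ` and at `P i ξ` have a fixed ratio.
  have hzξ : Tendsto (fun n => ‖(z n - s • (1 : H →L[ℂ] H)) ξ‖) atTop (𝓝 0) := by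
    have h1 : Tendsto (fun n => (z n - s • (1 : H →L[ℂ] H)) (P i ξ)) atTop (𝓝 0) := by
      have h2 := (hlim ξ).sub_const (s • P i ξ)
      have h3 : P i (e (P i ξ)) = s • P i ξ := by
        have := hee i
        rw [hPP] at this
        rw [this, map_smul]
      rw [h3, sub_self] at h2
      simpa using h2
    have h4 : ∀ n, ‖(z n - s • (1 : H →L[ℂ] H)) ξ‖
        = ‖(z n - s • (1 : H →L[ℂ] H)) (P i ξ)‖ / ‖P i ξ‖ := by
      intro n
      have hcm : ∀ k, (z n - s • (1 : H →L[ℂ] H)) * P k = P k * (z n - s • (1 : H →L[ℂ] H)) := by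
        intro k
        rw [sub_mul, mul_sub, hz n _ (hM k)]
        simp
      have h5 := norm_sq_apply_of_commute hξ hP hedge hcm i
      rw [← mul_pow] at h5
      have h6 := (pow_left_inj₀ (norm_nonneg _) (by positivity) two_ne_zero).1 h5
      rw [h6, mul_div_assoc, div_self (norm_ne_zero_iff.2 hi), mul_one]
    simp only [h4]
    simpa using h1.norm.div_const ‖P i ξ‖
  have hzj : Tendsto (fun n => z n (P i (P j ξ))) atTop (𝓝 (s • P i (P j ξ))) := by
    rw [← tendsto_sub_nhds_zero_iff]
    refine squeeze_zero_norm (fun n => ?_)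
      (by simpa using hzξ.const_mul ‖P i * P j‖)
    have e1 : z n (P i (P j ξ)) = P i (P j (z n ξ)) := by
      have := congrArg (· ξ) (hz n (P i * P j) (M.mul_mem (hM i) (hM j)))
      simpa using this
    have e2 : z n (P i (P j ξ)) - s • P i (P j ξ)
        = (P i * P j) ((z n - s • (1 : H →L[ℂ] H)) ξ) := by
      rw [e1]; simp
    rw [e2]
    exact ContinuousLinearMap.le_opNorm _ _
  -- Two limits of `z n (P i (P j ξ))`: centrality gives `s • P i (P j ξ)`, and the scalar
  -- compression gives a multiple of `P i ξ`.
  have huniq := tendsto_nhds_unique hzj (hlim (P j ξ))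
  rw [hee j, map_smul] at huniq
  have hs0 : s ≠ 0 := inner_self_ne_zero.2 hi
  rw [div_eq_inv_mul, ← smul_smul, ← huniq, smul_smul, inv_mul_cancel₀ hs0, one_smul]

end Rigidity

/-! ### Operators, isometries and kernels on Hilbert space tensor products. -/

section Tensor

variable {E F E' F' E'' F'' G : Type*} [NormedAddCommGroup E] [InnerProductSpace ℂ E]
  [NormedAddCommGroup F] [InnerProductSpace ℂ F] [NormedAddCommGroup E'] [InnerProductSpace ℂ E']
  [NormedAddCommGroup F'] [InnerProductSpace ℂ F'] [NormedAddCommGroup E'']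
  [InnerProductSpace ℂ E''] [NormedAddCommGroup F''] [InnerProductSpace ℂ F'']
  [NormedAddCommGroup G] [InnerProductSpace ℂ G]

theorem inner_inclTensor_tmul (x x' : E) (y y' : F) :
    inner ℂ (inclTensor E F (x ⊗ₜ y)) (inclTensor E F (x' ⊗ₜ y'))
      = inner ℂ x x' * inner ℂ y y' := by
  rw [LinearIsometry.inner_map_map, TensorProduct.inner_tmul]

theorem hilbertTensor_ext_inner {z z' : HilbertTensor E F}
    (h : ∀ x y, inner ℂ (inclTensor E F (x ⊗ₜ y)) z = inner ℂ (inclTensor E F (x ⊗ₜ y)) z') :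
    z = z' := by
  have : innerSL ℂ z = innerSL ℂ z' := hilbertTensor_ext fun x y => by
    rw [innerSL_apply_apply, innerSL_apply_apply, ← inner_conj_symm, h, inner_conj_symm]
  exact ext_inner_right ℂ fun w => congrArg (· w) this

theorem tensorOp_comp (S : E' →L[ℂ] E'') (T : F' →L[ℂ] F'') (S' : E →L[ℂ] E')
    (T' : F →L[ℂ] F') : (tensorOp S T).comp (tensorOp S' T') = tensorOp (S.comp S') (T.comp T') :=
  hilbertTensor_ext fun x y => by simp [tensorOp_pure]

theorem tensorOp_tensorOp (S : E' →L[ℂ] E'') (T : F' →L[ℂ] F'') (S' : E →L[ℂ] E')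
    (T' : F →L[ℂ] F') (z : HilbertTensor E F) :
    tensorOp S T (tensorOp S' T' z) = tensorOp (S.comp S') (T.comp T') z :=
  congrArg (· z) (tensorOp_comp S T S' T')

theorem tensorOp_one : tensorOp (1 : E →L[ℂ] E) (1 : F →L[ℂ] F) = 1 :=
  hilbertTensor_ext fun x y => by simp [tensorOp_pure]

theorem tensorOp_sub_left (S S' : E →L[ℂ] E') (T : F →L[ℂ] F') :
    tensorOp (S - S') T = tensorOp S T - tensorOp S' T :=
  hilbertTensor_ext fun x y => by simp [tensorOp_pure, TensorProduct.sub_tmul]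

theorem tensorOp_sub_right (S : E →L[ℂ] E') (T T' : F →L[ℂ] F') :
    tensorOp S (T - T') = tensorOp S T - tensorOp S T' :=
  hilbertTensor_ext fun x y => by simp [tensorOp_pure, TensorProduct.tmul_sub]

theorem tensorOp_smul_left (c : ℂ) (S : E →L[ℂ] E') (T : F →L[ℂ] F') :
    tensorOp (c • S) T = c • tensorOp S T :=
  hilbertTensor_ext fun x y => by simp [tensorOp_pure, ← TensorProduct.smul_tmul']

theorem tensorOp_smul_right (c : ℂ) (S : E →L[ℂ] E') (T : F →L[ℂ] F') :
    tensorOp S (c • T) = c • tensorOp S T :=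
  hilbertTensor_ext fun x y => by simp [tensorOp_pure]

theorem tensorOp_adjoint [CompleteSpace E] [CompleteSpace F] [CompleteSpace E']
    [CompleteSpace F'] (S : E →L[ℂ] E') (T : F →L[ℂ] F') :
    (tensorOp S T).adjoint = tensorOp S.adjoint T.adjoint :=
  hilbertTensor_ext fun x y => hilbertTensor_ext_inner fun x' y' => by
    rw [ContinuousLinearMap.adjoint_inner_right, tensorOp_pure, tensorOp_pure,
      inner_inclTensor_tmul, inner_inclTensor_tmul, ContinuousLinearMap.adjoint_inner_right,
      ContinuousLinearMap.adjoint_inner_right]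

theorem isStarProjection_tensorOp [CompleteSpace E] [CompleteSpace F] {P : E →L[ℂ] E}
    {Q : F →L[ℂ] F} (hP : IsStarProjection P) (hQ : IsStarProjection Q) :
    IsStarProjection (tensorOp P Q) where
  isIdempotentElem := by
    change (tensorOp P Q).comp (tensorOp P Q) = _
    rw [tensorOp_comp]
    exact congrArg₂ tensorOp hP.isIdempotentElem hQ.isIdempotentElem
  isSelfAdjoint := by
    rw [IsSelfAdjoint, ContinuousLinearMap.star_eq_adjoint, tensorOp_adjoint,
      ← ContinuousLinearMap.star_eq_adjoint, ← ContinuousLinearMap.star_eq_adjoint,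
      hP.isSelfAdjoint.star_eq, hQ.isSelfAdjoint.star_eq]

theorem norm_tensorOp_isometry (S : E →ₗᵢ[ℂ] E') (T : F →ₗᵢ[ℂ] F') (z : HilbertTensor E F) :
    ‖tensorOp S.toContinuousLinearMap T.toContinuousLinearMap z‖ = ‖z‖ := by
  refine dense_inclTensor.induction_on (p := fun z =>
    ‖tensorOp S.toContinuousLinearMap T.toContinuousLinearMap z‖ = ‖z‖) z
    (isClosed_eq (by fun_prop) (by fun_prop)) fun x => ?_
  rw [tensorOp_incl, LinearIsometry.norm_map, LinearIsometry.norm_map]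
  rw [TensorProduct.mapL_apply]
  exact TensorProduct.norm_map S T x

theorem exists_isometry_extending [CompleteSpace G] (f : E ⊗[ℂ] F →ₗᵢ[ℂ] G) :
    ∃ V : HilbertTensor E F →ₗᵢ[ℂ] G, ∀ z, V (inclTensor E F z) = f z := by
  obtain ⟨g, hg⟩ : ∃ g : HilbertTensor E F →L[ℂ] G, ∀ z, g (inclTensor E F z) = f z :=
    ⟨f.toLinearMap.extendOfNorm (inclTensor E F).toLinearMap, fun z =>
      LinearMap.extendOfNorm_eq dense_inclTensor ⟨1, fun x => by simp⟩ z⟩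
  have hn : ∀ z, ‖g z‖ = ‖z‖ := fun z => by
    refine dense_inclTensor.induction_on (p := fun z => ‖g z‖ = ‖z‖) z
      (isClosed_eq (by fun_prop) (by fun_prop)) fun x => ?_
    rw [hg, LinearIsometry.norm_map, LinearIsometry.norm_map]
  exact ⟨{ toLinearMap := g.toLinearMap, norm_map' := hn }, hg⟩

/-- A bilinear map that multiplies inner products extends to an isometry on the Hilbert space tensor
product. -/
theorem exists_isometry_of_inner_eq [CompleteSpace G] (B : E →ₗ[ℂ] F →ₗ[ℂ] G)
    (hB : ∀ x x' y y', inner ℂ (B x y) (B x' y') = inner ℂ x x' * inner ℂ y y') :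
    ∃ V : HilbertTensor E F →ₗᵢ[ℂ] G, ∀ x y, V (inclTensor E F (x ⊗ₜ y)) = B x y := by
  have hf : ∀ z z' : E ⊗[ℂ] F, inner ℂ (TensorProduct.lift B z) (TensorProduct.lift B z')
      = inner ℂ z z' := by
    intro z z'
    induction z using TensorProduct.induction_on with
    | zero => simp
    | add a b ha hb => rw [map_add, inner_add_left, inner_add_left, ha, hb]
    | tmul x y =>
      induction z' using TensorProduct.induction_on with
      | zero => simp
      | add a b ha hb => rw [map_add, inner_add_right, inner_add_right, ha, hb]
      | tmul x' y' =>
        rw [TensorProduct.lift.tmul, TensorProduct.lift.tmul, hB, TensorProduct.inner_tmul]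
  obtain ⟨V, hV⟩ := exists_isometry_extending ((TensorProduct.lift B).isometryOfInner hf)
  exact ⟨V, fun x y => (hV _).trans (TensorProduct.lift.tmul x y)⟩

/-- The kernel of `D ⊗ 1` is `ker D ⊗ F`: contracting `z` with any `y` in the second factor, by the
adjoint of `e ↦ e ⊗ y`, gives a vector of `ker D`. -/
theorem tensorOp_starProjection_ker_left [CompleteSpace E] [CompleteSpace F] {D : E →L[ℂ] E}
    (hD : IsSelfAdjoint D) {z : HilbertTensor E F} (hz : tensorOp D (1 : F →L[ℂ] F) z = 0) :
    tensorOp D.ker.starProjection (1 : F →L[ℂ] F) z = z := by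
  refine hilbertTensor_ext_inner fun x y => ?_
  let m : E →L[ℂ] HilbertTensor E F :=
    (inclTensor E F).toContinuousLinearMap ∘L (TensorProduct.mkL ℂ E F).flip y
  have hm : ∀ e, inner ℂ (inclTensor E F (e ⊗ₜ y)) z = inner ℂ e (m.adjoint z) := fun e =>
    (ContinuousLinearMap.adjoint_inner_right m e z).symm
  have hadj : ∀ S : E →L[ℂ] E, IsSelfAdjoint S → ∀ e,
      inner ℂ (inclTensor E F (e ⊗ₜ y)) (tensorOp S 1 z) = inner ℂ (S e) (m.adjoint z) := by
    intro S hS e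
    have h1 : (tensorOp S (1 : F →L[ℂ] F)).adjoint = tensorOp S 1 := by
      rw [tensorOp_adjoint, ← ContinuousLinearMap.star_eq_adjoint,
        ← ContinuousLinearMap.star_eq_adjoint, hS.star_eq, star_one]
    rw [← h1, ContinuousLinearMap.adjoint_inner_right, tensorOp_pure]
    exact hm (S e)
  have hk : m.adjoint z ∈ D.ker := by
    refine LinearMap.mem_ker.2 (ext_inner_left ℂ fun e => ?_)
    have := hadj D hD e
    rw [hz, inner_zero_right] at this
    rw [inner_zero_right, this]
    exact (ContinuousLinearMap.isSelfAdjoint_iff_isSymmetric.1 hD e _).symm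
  rw [hadj _ (isSelfAdjoint_starProjection _), hm, Submodule.inner_starProjection_left_eq_right,
    Submodule.starProjection_eq_self_iff.2 hk]

theorem tensorOp_starProjection_ker_right [CompleteSpace E] [CompleteSpace F] {D : F →L[ℂ] F}
    (hD : IsSelfAdjoint D) {z : HilbertTensor E F} (hz : tensorOp (1 : E →L[ℂ] E) D z = 0) :
    tensorOp (1 : E →L[ℂ] E) D.ker.starProjection z = z := by
  refine hilbertTensor_ext_inner fun x y => ?_
  let m : F →L[ℂ] HilbertTensor E F := adjoinVec x
  have hm : ∀ f, inner ℂ (inclTensor E F (x ⊗ₜ f)) z = inner ℂ f (m.adjoint z) := fun f =>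
    (ContinuousLinearMap.adjoint_inner_right m f z).symm
  have hadj : ∀ S : F →L[ℂ] F, IsSelfAdjoint S → ∀ f,
      inner ℂ (inclTensor E F (x ⊗ₜ f)) (tensorOp 1 S z) = inner ℂ (S f) (m.adjoint z) := by
    intro S hS f
    have h1 : (tensorOp (1 : E →L[ℂ] E) S).adjoint = tensorOp 1 S := by
      rw [tensorOp_adjoint, ← ContinuousLinearMap.star_eq_adjoint,
        ← ContinuousLinearMap.star_eq_adjoint, hS.star_eq, star_one]
    rw [← h1, ContinuousLinearMap.adjoint_inner_right, tensorOp_pure]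
    exact hm (S f)
  have hk : m.adjoint z ∈ D.ker := by
    refine LinearMap.mem_ker.2 (ext_inner_left ℂ fun e => ?_)
    have := hadj D hD e
    rw [hz, inner_zero_right] at this
    rw [inner_zero_right, this]
    exact (ContinuousLinearMap.isSelfAdjoint_iff_isSymmetric.1 hD e _).symm
  rw [hadj _ (isSelfAdjoint_starProjection _), hm, Submodule.inner_starProjection_left_eq_right,
    Submodule.starProjection_eq_self_iff.2 hk]

end Tensor

/-! ### Connectedness of the non-orthogonality graph. -/

section Orthogonality

/-- The non-orthogonality graph of the vectors of a unique maximizer is connected. -/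
theorem IsUniqueThetaMaximizer.mem_of_inner_eq_zero {ι H : Type*} [Fintype ι]
    [NormedAddCommGroup H] [InnerProductSpace ℂ H] {G : SimpleGraph ι} {w : ι → ℝ} {ψ : H}
    {v : ι → H} {η : ι → ℂ} (hη : ∀ i, η i ≠ 0) (hv : ∀ i, v i ≠ 0)
    (hX : IsUniqueThetaMaximizer G w (vectorMatrix ψ fun i => η i • v i)) {T : Set ι}
    (hT : ∀ i ∈ T, ∀ j ∉ T, inner ℂ (v i) (v j) = 0) (hne : T.Nonempty) (j : ι) : j ∈ T := by
  classical
  by_contra hj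
  obtain ⟨i₀, hi₀⟩ := hne
  -- The projection onto `K` fixes the vectors in `T` and kills the others, so it preserves the
  -- constraints and must scale the Gram matrix. The factor is `1` at `i₀` and `0` at `j`.
  set K := Submodule.span ℂ (v '' T) with hK
  have : FiniteDimensional ℂ K := FiniteDimensional.span_of_finite ℂ (Set.toFinite _)
  have hin : ∀ i ∈ T, K.starProjection (η i • v i) = η i • v i := fun i hi =>
    Submodule.starProjection_eq_self_iff.2
      (K.smul_mem _ (Submodule.subset_span ⟨i, hi, rfl⟩))
  have hout : ∀ i ∉ T, K.starProjection (η i • v i) = 0 := fun i hi => by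
    rw [Submodule.starProjection_apply_eq_zero_iff]
    refine Kᗮ.smul_mem _ ((Submodule.mem_orthogonal _ _).2 fun y hy => ?_)
    induction hy using Submodule.span_induction with
    | mem x hx => obtain ⟨k, hk, rfl⟩ := hx; exact hT k hk i hi
    | zero => simp
    | add x y _ _ hx hy => rw [inner_add_left, hx, hy, add_zero]
    | smul c x _ hx => rw [inner_smul_left, hx, mul_zero]
  have h := hX.vectorMatrix_map K.starProjection
    (fun i => by
      by_cases hi : i ∈ T
      · rw [hin i hi]
        refine (hX.1.1.diag i).trans ?_
        change inner ℂ (η i • v i) ψ = _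
        conv_lhs => rw [← hin i hi]
        rw [Submodule.inner_starProjection_left_eq_right]
      · rw [hout i hi, inner_zero_left, inner_zero_left])
    (fun i k hik => by
      by_cases hi : i ∈ T
      · by_cases hk : k ∈ T
        · rw [hin i hi, hin k hk]
          exact hX.1.1.edge i k hik
        · rw [hout k hk, inner_zero_left]
      · rw [hout i hi, inner_zero_right])
  have e : ∀ i, inner ℂ (K.starProjection (η i • v i)) (K.starProjection (η i • v i))
      = ((‖K.starProjection ψ‖ ^ 2 : ℝ) : ℂ) * inner ℂ (η i • v i) (η i • v i) := fun i =>
    congrFun (congrFun h (some i)) (some i)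
  have hne : ∀ i, inner ℂ (η i • v i) (η i • v i) ≠ 0 := fun i =>
    inner_self_ne_zero.2 (smul_ne_zero (hη i) (hv i))
  have e1 := e i₀
  rw [hin i₀ hi₀, eq_comm, mul_eq_right₀ (hne i₀)] at e1
  have e2 := e j
  rw [hout j hj, inner_zero_left, e1, one_mul] at e2
  exact hne j e2.symm

end Orthogonality

/-! ### Two-dimensional blocks of a pair of projections. -/

section Local

theorem sum_inner_smul_of_orthonormal {u u' : Qubit} (hu : ‖u‖ = 1) (hu' : ‖u'‖ = 1)
    (h : inner ℂ u u' = 0) (x : Qubit) : inner ℂ u x • u + inner ℂ u' x • u' = x := by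
  have ho : Orthonormal ℂ ![u, u'] := by
    refine ⟨fun i => by fin_cases i <;> simpa, fun i j hij => ?_⟩
    fin_cases i <;> fin_cases j <;> simp_all [inner_eq_zero_symm.1 h]
  have hs := ho.linearIndependent.span_eq_top_of_card_eq_finrank (by simp)
  have := (OrthonormalBasis.mk ho hs.ge).sum_repr' x
  simpa [Fin.sum_univ_two] using this

theorem inner_eq_of_orthonormal {u u' : Qubit} (hu : ‖u‖ = 1) (hu' : ‖u'‖ = 1)
    (h : inner ℂ u u' = 0) (x y : Qubit) :
    inner ℂ x y = inner ℂ x u * inner ℂ u y + inner ℂ x u' * inner ℂ u' y := by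
  conv_lhs => rw [← sum_inner_smul_of_orthonormal hu hu' h y]
  rw [inner_add_right, inner_smul_right, inner_smul_right]
  ring

variable {H : Type*} [NormedAddCommGroup H] [InnerProductSpace ℂ H] [CompleteSpace H]

/-- The operator whose kernel is the multiplicity space of the two-dimensional blocks of two
projections `P`, `P'` with squared overlap `|c|²`. -/
def blockDefect (P P' : H →L[ℂ] H) (c : ℂ) : H →L[ℂ] H :=
  P * P' * P - (c * star c) • (1 : H →L[ℂ] H)

theorem isSelfAdjoint_blockDefect {P P' : H →L[ℂ] H} (hP : IsStarProjection P)
    (hP' : IsStarProjection P') (c : ℂ) : IsSelfAdjoint (blockDefect P P' c) := by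
  have h1 : star (P * P' * P) = P * P' * P := by
    rw [star_mul, star_mul, hP.isSelfAdjoint.star_eq, hP'.isSelfAdjoint.star_eq, mul_assoc]
  rw [IsSelfAdjoint, blockDefect, star_sub, h1, star_smul, star_one, star_mul, star_star]

/-- Two projections act on their blocks with squared overlap `|⟨u', u⟩|²` as the rank one
projections onto `u` and `u'` do. -/
theorem exists_block_isometry {P P' : H →L[ℂ] H} (hP : IsStarProjection P)
    (hP' : IsStarProjection P') {u v u' : Qubit} (hu : ‖u‖ = 1) (hv : ‖v‖ = 1) (hu' : ‖u'‖ = 1)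
    (huv : inner ℂ u v = 0) (h1 : inner ℂ u' u ≠ 0) (h2 : inner ℂ v u' ≠ 0) :
    ∃ V : HilbertTensor Qubit (blockDefect P P' (inner ℂ u' u)).ker →ₗᵢ[ℂ] H,
      (∀ k, V (inclTensor _ _ (u ⊗ₜ k)) = k) ∧
      (∀ x k, P (V (inclTensor _ _ (x ⊗ₜ k))) = inner ℂ u x • V (inclTensor _ _ (u ⊗ₜ k))) ∧
      (∀ x k, P' (V (inclTensor _ _ (x ⊗ₜ k)))
        = inner ℂ u' x • V (inclTensor _ _ (u' ⊗ₜ k))) := by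
  set γ : ℂ := inner ℂ u' u with hγ
  set δ : ℂ := inner ℂ v u' with hδ
  set μ : ℂ := γ * star γ with hμ
  have hγ' : inner ℂ u u' = star γ := (inner_conj_symm u u').symm
  have hδ' : inner ℂ u' v = star δ := (inner_conj_symm u' v).symm
  have hγs : star γ ≠ 0 := star_ne_zero.2 h1
  have hδs : star δ ≠ 0 := star_ne_zero.2 h2
  have hμ0 : μ ≠ 0 := mul_ne_zero h1 hγs
  have hstarμ : (starRingEnd ℂ) μ = μ := by
    rw [hμ, map_mul, mul_comm]; simp
  have hsum : μ + star δ * δ = 1 := by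
    have := inner_eq_of_orthonormal hu hv huv u' u'
    rw [hγ', hδ', inner_self_eq_norm_sq_to_K, hu', RCLike.ofReal_one, one_pow] at this
    exact this.symm
  set K := (blockDefect P P' γ).ker with hK
  have hPP : ∀ x, P (P x) = P x := fun x => congrArg (· x) hP.isIdempotentElem
  have hPP' : ∀ x, P' (P' x) = P' x := fun x => congrArg (· x) hP'.isIdempotentElem
  have hk0 : ∀ k : K, P (P' (P k)) = μ • (k : H) := fun k => by
    have : blockDefect P P' γ k = 0 := k.2
    exact sub_eq_zero.1 this
  have hPk : ∀ k : K, P k = (k : H) := fun k => by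
    have : (k : H) = μ⁻¹ • P (P' (P k)) := by
      rw [hk0, smul_smul, inv_mul_cancel₀ hμ0, one_smul]
    rw [this, map_smul, hPP]
  have hPk' : ∀ k : K, P (P' k) = μ • (k : H) := fun k => by
    have := hk0 k
    rwa [hPk] at this
  have hin : ∀ k l : K, inner ℂ (k : H) (P' l) = μ * inner ℂ (k : H) (l : H) := fun k l => by
    conv_lhs => rw [← hPk k]
    rw [hP.inner_apply_left, hPk', inner_smul_right]
  have hin2 : ∀ k l : K, inner ℂ (P' k) (l : H) = μ * inner ℂ (k : H) (l : H) := fun k l => by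
    rw [hP'.inner_apply_left, hin]
  have hin3 : ∀ k l : K, inner ℂ (P' k) (P' l) = μ * inner ℂ (k : H) (l : H) := fun k l => by
    rw [hP'.inner_apply_left, hPP', hin]
  -- The vector `P' k - μ k` is the part of `P' k` orthogonal to the range of `P`, of squared norm
  -- `μ(1 - μ)‖k‖² = |γδ|²‖k‖²`. Dividing by `δγ` normalizes it and fixes the phase so that `u' ⊗ k`
  -- is sent to `γ⁻¹ P' k`.
  set c : ℂ := (δ * γ)⁻¹ with hc
  let s : K →ₗ[ℂ] H :=
    c • (P'.toLinearMap ∘ₗ K.subtype - μ • K.subtype)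
  have hs : ∀ k, s k = c • (P' k - μ • (k : H)) := fun k => rfl
  let B : Qubit →ₗ[ℂ] K →ₗ[ℂ] H :=
    (innerSL ℂ u).toLinearMap.smulRight K.subtype + (innerSL ℂ v).toLinearMap.smulRight s
  have hB : ∀ x k, B x k = inner ℂ u x • (k : H) + inner ℂ v x • s k := fun x k => rfl
  have hks : ∀ k l : K, inner ℂ (k : H) (s l) = 0 := fun k l => by
    rw [hs, inner_smul_right, inner_sub_right, inner_smul_right, hin, sub_self, mul_zero]
  have hsk : ∀ k l : K, inner ℂ (s k) (l : H) = 0 := fun k l => inner_eq_zero_symm.1 (hks l k)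
  have hss : ∀ k l : K, inner ℂ (s k) (s l) = inner ℂ (k : H) (l : H) := fun k l => by
    rw [hs, hs, inner_smul_left, inner_smul_right, inner_sub_left, inner_sub_right,
      inner_sub_right, inner_smul_left, inner_smul_left, inner_smul_right, inner_smul_right,
      hin, hin2, hin3, hstarμ]
    have e1 : (starRingEnd ℂ) c = (star δ * star γ)⁻¹ := by
      rw [hc, map_inv₀, map_mul]; rfl
    rw [e1, hc]
    field_simp
    linear_combination -(μ * inner ℂ (k : H) (l : H)) * hsum
  obtain ⟨V, hV⟩ := exists_isometry_of_inner_eq B (fun x x' k k' => by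
    rw [hB, hB, inner_add_left, inner_add_right, inner_add_right, inner_smul_left,
      inner_smul_left, inner_smul_left, inner_smul_left, inner_smul_right, inner_smul_right,
      inner_smul_right, inner_smul_right, hks, hsk, hss, inner_conj_symm, inner_conj_symm,
      inner_eq_of_orthonormal hu hv huv x x', Submodule.coe_inner]
    ring)
  have huu : inner ℂ u u = (1 : ℂ) := by rw [inner_self_eq_norm_sq_to_K, hu]; simp
  have hVu : ∀ k, V (inclTensor _ _ (u ⊗ₜ k)) = k := fun k => by
    rw [hV, hB, huu, inner_eq_zero_symm.1 huv, one_smul, zero_smul, add_zero]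
  refine ⟨V, hVu, fun x k => ?_, fun x k => ?_⟩
  · rw [hVu, hV, hB, hs]
    simp only [map_add, map_smul, map_sub, hPk, hPk', sub_self, smul_zero, add_zero]
  · have hVu' : V (inclTensor _ _ (u' ⊗ₜ k)) = γ⁻¹ • P' k := by
      rw [hV, hB, hs, hγ', ← hδ, smul_smul, smul_sub, smul_smul]
      have e : δ * c = γ⁻¹ := by rw [hc]; field_simp
      have e' : γ⁻¹ * μ = star γ := by rw [hμ]; field_simp
      rw [e, e']
      abel
    rw [hVu', hV, hB, hs]
    simp only [map_add, map_smul, map_sub, hPP', smul_smul]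
    have e : inner ℂ u' x * γ⁻¹ = inner ℂ u x + inner ℂ v x * c * (1 - μ) := by
      rw [inner_eq_of_orthonormal hu hv huv u' x, ← hγ, hδ', ← hsum, hc]
      field_simp
      ring
    rw [e]
    module

end Local

/-! ### Reduction of four labels to one outcome per measurement. -/

section Labels

/-- The other outcome of the same measurement. -/
def otherOutcome (p : Label) : Label := (1 - p.1, p.2)

theorem eq_or_eq_otherOutcome {p r : Label} (h : r.2 = p.2) : r = p ∨ r = otherOutcome p := by
  revert p r; decide

theorem eq_or_eq_otherOutcome_of_ne {p p' r : Label} (hp : p'.2 ≠ p.2) (h : r.2 ≠ p.2) :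
    r = p' ∨ r = otherOutcome p' := by
  revert p p' r; decide

theorem LocallyExclusive.eq_otherOutcome {p r : Label} (h : LocallyExclusive p r) :
    r = otherOutcome p :=
  (eq_or_eq_otherOutcome h.1.symm).resolve_left fun e => h.2 (e ▸ rfl)

theorem IsBinaryPair.inner_otherOutcome {H : Type*} [NormedAddCommGroup H]
    [InnerProductSpace ℂ H] {a : Label → H} (ha : IsBinaryPair a) (p : Label) :
    inner ℂ (a p) (a (otherOutcome p)) = 0 := by
  obtain ⟨k, x⟩ := p
  fin_cases k
  · exact ha.2 x
  · exact inner_eq_zero_symm.1 (ha.2 x)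

theorem add_otherOutcome_eq_one {R : Type*} [Ring R] {A : Label → R}
    (h : ∀ x : Fin 2, A (0, x) + A (1, x) = 1) (p : Label) : A p + A (otherOutcome p) = 1 := by
  obtain ⟨k, x⟩ := p
  fin_cases k
  · exact h x
  · exact (add_comm _ _).trans (h x)

theorem otherOutcome_eq_one_sub {R : Type*} [Ring R] {A : Label → R}
    (h : ∀ x : Fin 2, A (0, x) + A (1, x) = 1) (p : Label) : A (otherOutcome p) = 1 - A p :=
  eq_sub_of_add_eq' (add_otherOutcome_eq_one h p)

/-- In the algebra generated by the projections of two parties with two binary measurements each,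
all corners at joint events are central. -/
theorem exists_central_corner {R : Type*} [Ring R] [Algebra ℂ R] {A B : Label → R}
    (hA : ∀ p, A p * A p = A p) (hB : ∀ q, B q * B q = B q)
    (hA1 : ∀ x : Fin 2, A (0, x) + A (1, x) = 1) (hB1 : ∀ x : Fin 2, B (0, x) + B (1, x) = 1)
    (hAB : ∀ p q, Commute (A p) (B q)) (p q : Label) {m : R}
    (hm : m ∈ Algebra.adjoin ℂ (Set.range A ∪ Set.range B)) :
    ∃ z : R, (∀ n ∈ Algebra.adjoin ℂ (Set.range A ∪ Set.range B), z * n = n * z) ∧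
      (A p * B q) * m * (A p * B q) = z * (A p * B q) := by
  have hex : ∀ p : Label, ∃ p' : Label, p'.2 ≠ p.2 := by decide
  obtain ⟨p', hp'⟩ := hex p
  obtain ⟨q', hq'⟩ := hex q
  set S : Set R := {A p, A p', B q, B q'} with hS
  -- One outcome of each measurement generates the algebra, the other outcome being its complement.
  have hle : Algebra.adjoin ℂ (Set.range A ∪ Set.range B) ≤ Algebra.adjoin ℂ S := by
    refine Algebra.adjoin_le ?_
    have gen : ∀ {C : Label → R} {p p' : Label}, (∀ x : Fin 2, C (0, x) + C (1, x) = 1) →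
        p'.2 ≠ p.2 → C p ∈ Algebra.adjoin ℂ S → C p' ∈ Algebra.adjoin ℂ S →
        ∀ r, C r ∈ Algebra.adjoin ℂ S := by
      intro C p p' hC hne h h' r
      by_cases hr : r.2 = p.2
      · rcases eq_or_eq_otherOutcome hr with rfl | rfl
        · exact h
        · rw [otherOutcome_eq_one_sub hC]; exact Subalgebra.sub_mem _ (Subalgebra.one_mem _) h
      · rcases eq_or_eq_otherOutcome_of_ne hne hr with rfl | rfl
        · exact h'
        · rw [otherOutcome_eq_one_sub hC]; exact Subalgebra.sub_mem _ (Subalgebra.one_mem _) h'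
    rintro x (⟨r, rfl⟩ | ⟨r, rfl⟩)
    · exact gen hA1 hp' (Algebra.subset_adjoin (by simp [hS]))
        (Algebra.subset_adjoin (by simp [hS])) r
    · exact gen hB1 hq' (Algebra.subset_adjoin (by simp [hS]))
        (Algebra.subset_adjoin (by simp [hS])) r
  obtain ⟨z, hz, e⟩ := exists_central_mul_of_mem_adjoin (hA p) (hA p') (hB q) (hB q')
    (hAB _ _) (hAB _ _) (hAB _ _) (hAB _ _) (hle hm)
  refine ⟨z, fun n hn => ?_, e⟩
  have h1 : Algebra.adjoin ℂ S ≤ Subalgebra.centralizer ℂ {z} := by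
    refine Algebra.adjoin_le fun g hg => ?_
    rw [SetLike.mem_coe, Subalgebra.mem_centralizer_iff]
    rintro _ rfl
    exact ((Subalgebra.mem_centralizer_iff ℂ).1 hz g hg).symm
  exact (Subalgebra.mem_centralizer_iff ℂ).1 (h1 (hle hn)) z rfl

variable {H : Type*} [NormedAddCommGroup H] [InnerProductSpace ℂ H] [CompleteSpace H]

/-- The block isometry handles `p` and `p'`; complementary outcomes follow from the resolution of
the identity on both sides. -/
theorem exists_local_isometry {P : Label → H →L[ℂ] H} (hP : ∀ p, IsStarProjection (P p))
    (hC : ∀ x : Fin 2, P (0, x) + P (1, x) = 1) {a : Label → Qubit} (ha : IsBinaryPair a)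
    {p p' : Label} (hne : p'.2 ≠ p.2) (h1 : inner ℂ (a p') (a p) ≠ 0)
    (h2 : inner ℂ (a (otherOutcome p)) (a p') ≠ 0) :
    ∃ V : HilbertTensor Qubit (blockDefect (P p) (P p') (inner ℂ (a p') (a p))).ker →ₗᵢ[ℂ] H,
      (∀ k, V (inclTensor _ _ (a p ⊗ₜ k)) = k) ∧
      (∀ r x k, P r (V (inclTensor _ _ (x ⊗ₜ k)))
        = inner ℂ (a r) x • V (inclTensor _ _ (a r ⊗ₜ k))) := by
  obtain ⟨V, hV, hVp, hVp'⟩ := exists_block_isometry (hP p) (hP p') (ha.1 p)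
    (ha.1 (otherOutcome p)) (ha.1 p') (ha.inner_otherOutcome p) h1 h2
  refine ⟨V, hV, ?_⟩
  have other : ∀ s, (∀ x k, P s (V (inclTensor _ _ (x ⊗ₜ k)))
        = inner ℂ (a s) x • V (inclTensor _ _ (a s ⊗ₜ k))) → ∀ x k,
      P (otherOutcome s) (V (inclTensor _ _ (x ⊗ₜ k)))
        = inner ℂ (a (otherOutcome s)) x • V (inclTensor _ _ (a (otherOutcome s) ⊗ₜ k)) := by
    intro s hs x k
    have e := sum_inner_smul_of_orthonormal (ha.1 s) (ha.1 (otherOutcome s))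
      (ha.inner_otherOutcome s) x
    rw [otherOutcome_eq_one_sub hC, _root_.sub_apply, hs, one_apply_eq_self,
      sub_eq_iff_eq_add']
    conv_lhs => rw [← e]
    rw [TensorProduct.add_tmul, ← TensorProduct.smul_tmul', ← TensorProduct.smul_tmul', map_add,
      map_add, map_smul, map_smul, map_smul, map_smul]
  intro r
  by_cases hr : r.2 = p.2
  · rcases eq_or_eq_otherOutcome hr with rfl | rfl
    · exact hVp
    · exact other _ hVp
  · rcases eq_or_eq_otherOutcome_of_ne hne hr with rfl | rfl
    · exact hVp'
    · exact other _ hVp'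

end Labels

/-! ### Choice of the events that fix the local angles. -/

section Events

variable {I : Finset (Label × Label)} {a b : Label → Qubit}

theorem eq_zero_of_inner_eq_zero_of_span {E κ : Type*} [NormedAddCommGroup E]
    [InnerProductSpace ℂ E] {c : κ → E} {S : Set κ} (h : Submodule.span ℂ (c '' S) = ⊤) {x : E}
    (hx : ∀ s ∈ S, inner ℂ x (c s) = 0) : x = 0 := by
  have : x ∈ (Submodule.span ℂ (c '' S))ᗮ := by
    rw [Submodule.mem_orthogonal']
    intro y hy
    induction hy using Submodule.span_induction with
    | mem y hy => obtain ⟨s, hs, rfl⟩ := hy; exact hx s hs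
    | zero => simp
    | add y z _ _ hy hz => rw [inner_add_right, hy, hz, add_zero]
    | smul t y _ hy => rw [inner_smul_right, hy, mul_zero]
  rw [h, Submodule.top_orthogonal_eq_bot] at this
  exact this

theorem HasLinkedSpanningEvents.span_eq_top {LA LB HA HB : Type*} [DecidableEq LA]
    [NormedAddCommGroup HA] [InnerProductSpace ℂ HA] [NormedAddCommGroup HB]
    [InnerProductSpace ℂ HB] {I : Finset (LA × LB)} {a : LA → HA} {b : LB → HB}
    (h : HasLinkedSpanningEvents I a b) :
    Submodule.span ℂ (Set.range fun i : I => a i.1.1 ⊗ₜ[ℂ] b i.1.2) = ⊤ := by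
  obtain ⟨JB, JA, -, -, hI, hb, ha, -⟩ := h
  set K := Submodule.span ℂ (Set.range fun i : I => a i.1.1 ⊗ₜ[ℂ] b i.1.2) with hK
  have h1 : ∀ q ∈ JB, ∀ x, x ⊗ₜ[ℂ] b q ∈ K := by
    intro q hq x
    have hx : x ∈ Submodule.span ℂ (a '' (JA q : Set LA)) := by rw [ha q hq]; trivial
    induction hx using Submodule.span_induction with
    | mem x hx =>
      obtain ⟨p, hp, rfl⟩ := hx
      exact Submodule.subset_span ⟨⟨(p, q), hI q hq p hp⟩, rfl⟩
    | zero => rw [TensorProduct.zero_tmul]; exact K.zero_mem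
    | add x y _ _ hx hy => rw [TensorProduct.add_tmul]; exact K.add_mem hx hy
    | smul c x _ hx => rw [← TensorProduct.smul_tmul']; exact K.smul_mem c hx
  rw [eq_top_iff, ← TensorProduct.span_tmul_eq_top, Submodule.span_le]
  rintro _ ⟨x, y, rfl⟩
  have hy : y ∈ Submodule.span ℂ (b '' (JB : Set LB)) := by rw [hb]; trivial
  rw [SetLike.mem_coe]
  induction hy using Submodule.span_induction with
  | mem y hy => obtain ⟨q, hq, rfl⟩ := hy; exact h1 q hq x
  | zero => rw [TensorProduct.tmul_zero]; exact K.zero_mem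
  | add y z _ _ hy hz => rw [TensorProduct.tmul_add]; exact K.add_mem hy hz
  | smul c y _ hy => rw [TensorProduct.tmul_smul]; exact K.smul_mem c hy

/-- Three events that determine the angle between the two measurements of each party. -/
theorem exists_linked_events (ha : IsBinaryPair a) (hb : IsBinaryPair b)
    (hconn : ∀ T : Set I, (∀ i ∈ T, ∀ j ∉ T,
      inner ℂ (a i.1.1 ⊗ₜ[ℂ] b i.1.2) (a j.1.1 ⊗ₜ[ℂ] b j.1.2) = 0) → T.Nonempty → ∀ j, j ∈ T)
    (hlink : HasLinkedSpanningEvents I a b) :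
    ∃ p p' q q' r : Label, (p, q) ∈ I ∧ (p, q') ∈ I ∧ (p', r) ∈ I ∧ p'.2 ≠ p.2 ∧ q'.2 ≠ q.2 ∧
      inner ℂ (a p') (a p) ≠ 0 ∧ inner ℂ (a (otherOutcome p)) (a p') ≠ 0 ∧
      inner ℂ (b q') (b q) ≠ 0 ∧ inner ℂ (b (otherOutcome q)) (b q') ≠ 0 ∧
      inner ℂ (b r) (b q) ≠ 0 := by
  obtain ⟨JB, JA, hcard, -, hI, hbs, has, hG⟩ := hlink
  have hane : ∀ p, a p ≠ 0 := fun p h => by simpa [h] using ha.1 p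
  have hbne : ∀ p, b p ≠ 0 := fun p h => by simpa [h] using hb.1 p
  rw [finrank_euclideanSpace_fin] at hcard
  have hnt : Nontrivial JB := by
    rw [← Fintype.one_lt_card_iff_nontrivial, Fintype.card_coe]; omega
  obtain ⟨q₀⟩ := hG.nonempty
  -- Bob's set has two labels, so connectedness means that they are joined: their vectors overlap
  -- and they share an Alice label `p`.
  obtain ⟨q₁, hadj⟩ := hG.preconnected.exists_adj_of_nontrivial q₀
  obtain ⟨hne, hinner, p, hp⟩ := hadj
  have hJB : JB = {q₀.1, q₁.1} := by
    symm
    refine Finset.eq_of_subset_of_card_le ?_ ?_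
    · intro x hx
      rcases Finset.mem_insert.1 hx with rfl | hx
      · exact q₀.2
      · rw [Finset.mem_singleton.1 hx]; exact q₁.2
    · rw [hcard, Finset.card_pair (fun h => hne (Subtype.ext h))]
  have hpq₀ : (p, q₀.1) ∈ I := hI _ q₀.2 p (Finset.mem_of_mem_inter_left hp)
  have hpq₁ : (p, q₁.1) ∈ I := hI _ q₁.2 p (Finset.mem_of_mem_inter_right hp)
  have hzero : ∀ x : Qubit, inner ℂ x (b q₀) = 0 → inner ℂ x (b q₁) = 0 → x = 0 := by
    intro x h0 h1
    refine eq_zero_of_inner_eq_zero_of_span hbs fun s hs => ?_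
    rw [hJB] at hs
    rcases Finset.mem_insert.1 (Finset.mem_coe.1 hs) with rfl | hs
    · exact h0
    · rw [Finset.mem_singleton.1 hs]; exact h1
  have hop := ha.inner_otherOutcome p
  -- Otherwise each Alice vector of an event is orthogonal to `a p` or to its complement, and the
  -- events split into two mutually orthogonal classes. By connectedness all lie in the class of
  -- `(p, q₀)`, so the Alice vectors cannot span.
  obtain ⟨i, hi1, hi2⟩ : ∃ i : I, inner ℂ (a i.1.1) (a p) ≠ 0 ∧
      inner ℂ (a (otherOutcome p)) (a i.1.1) ≠ 0 := by
    by_contra! hcon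
    have hall := hconn {i | inner ℂ (a (otherOutcome p)) (a i.1.1) = 0} (fun i hi j hj => by
      have hj0 : inner ℂ (a j.1.1) (a p) = 0 := by
        by_contra h; exact hj (hcon j h)
      rw [TensorProduct.inner_tmul,
        inner_eq_of_orthonormal (ha.1 p) (ha.1 (otherOutcome p)) hop, inner_eq_zero_symm.1 hj0,
        inner_eq_zero_symm.1 hi]
      ring) ⟨⟨(p, q₀), hpq₀⟩, inner_eq_zero_symm.1 hop⟩
    exact hane (otherOutcome p) (eq_zero_of_inner_eq_zero_of_span (has q₀ q₀.2)
      fun s hs => hall ⟨(s, q₀), hI _ q₀.2 s hs⟩)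
  have hp2 : i.1.1.2 ≠ p.2 := fun h => by
    rcases eq_or_eq_otherOutcome h with h | h
    · rw [h] at hi2; exact hi2 (inner_eq_zero_symm.1 hop)
    · rw [h] at hi1; exact hi1 (inner_eq_zero_symm.1 hop)
  have main : ∀ q q' : Label, q ≠ q' → inner ℂ (b q') (b q) ≠ 0 →
      (∀ x : Qubit, inner ℂ x (b q) = 0 → inner ℂ x (b q') = 0 → x = 0) →
      q'.2 ≠ q.2 ∧ inner ℂ (b (otherOutcome q)) (b q') ≠ 0 := by
    intro q q' hqq hin hz
    have hoq := inner_eq_zero_symm.1 (hb.inner_otherOutcome q)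
    refine ⟨fun h => ?_, fun h => hbne _ (hz _ hoq h)⟩
    rcases eq_or_eq_otherOutcome h with h | h
    · exact hqq h.symm
    · rw [h] at hin; exact hin hoq
  have hne' : q₀.1 ≠ q₁.1 := fun h => hne (Subtype.ext h)
  have hinner' : inner ℂ (b q₁) (b q₀) ≠ 0 := fun h => hinner (inner_eq_zero_symm.1 h)
  -- Bob's vector in the event `i` overlaps with at least one of the spanning pair; that label takes
  -- the role of `q`.
  by_cases hr : inner ℂ (b i.1.2) (b q₀) = 0
  · have hr' : inner ℂ (b i.1.2) (b q₁) ≠ 0 := fun h => hbne _ (hzero _ hr h)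
    obtain ⟨m1, m2⟩ := main q₁ q₀ hne'.symm hinner fun x h0 h1 => hzero x h1 h0
    exact ⟨p, i.1.1, q₁, q₀, i.1.2, hpq₁, hpq₀, i.2, hp2, m1, hi1, hi2, hinner, m2, hr'⟩
  · obtain ⟨m1, m2⟩ := main q₀ q₁ hne' hinner' hzero
    exact ⟨p, i.1.1, q₀, q₁, i.1.2, hpq₀, hpq₁, i.2, hp2, m1, hi1, hi2, hinner', m2, hr⟩

end Events

/-! ### Consequences of optimality for a bipartite realization. -/

section Realization

variable {HA HB : Type*} [NormedAddCommGroup HA] [InnerProductSpace ℂ HA]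
  [NormedAddCommGroup HB] [InnerProductSpace ℂ HB]

theorem mul_eq_zero_of_locallyExclusive {R : Type*} [Ring R] {P : Label → R}
    (hP : ∀ p, P p * P p = P p) (hC : ∀ x : Fin 2, P (0, x) + P (1, x) = 1) {p r : Label}
    (h : LocallyExclusive p r) : P p * P r = 0 := by
  rw [h.eq_otherOutcome, otherOutcome_eq_one_sub hC, mul_sub, mul_one, hP, sub_self]

theorem tensorOp_mul_tensorOp (S S' : HA →L[ℂ] HA) (T T' : HB →L[ℂ] HB) :
    tensorOp S T * tensorOp S' T' = tensorOp (S * S') (T * T') :=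
  tensorOp_comp S T S' T'

theorem tensorOp_mul_eq_zero_of_adj {I : Finset (Label × Label)} {PA : Label → HA →L[ℂ] HA}
    {PB : Label → HB →L[ℂ] HB} (hPA : ∀ p, PA p * PA p = PA p) (hPB : ∀ p, PB p * PB p = PB p)
    (hCA : ∀ x : Fin 2, PA (0, x) + PA (1, x) = 1) (hCB : ∀ x : Fin 2, PB (0, x) + PB (1, x) = 1)
    (i j : I) (h : (exclusivityGraph I).Adj i j) :
    tensorOp (PA i.1.1) (PB i.1.2) * tensorOp (PA j.1.1) (PB j.1.2) = 0 := by
  rw [tensorOp_mul_tensorOp]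
  rcases h with h | h
  · rw [mul_eq_zero_of_locallyExclusive hPA hCA h]
    simpa using tensorOp_smul_left 0 (1 : HA →L[ℂ] HA) (PB i.1.2 * PB j.1.2)
  · rw [mul_eq_zero_of_locallyExclusive hPB hCB h]
    simpa using tensorOp_smul_right 0 (PA i.1.1 * PA j.1.1) (1 : HB →L[ℂ] HB)

/-- Optimality forces the joint projections to act on the normalized vectors of a realization as the
rank one projections of the reference system do. -/
theorem tensorOp_apply_eq_smul [CompleteSpace HA] [CompleteSpace HB]
    {I : Finset (Label × Label)} {w : I → ℝ} (hw : ∀ i, 0 < w i)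
    {ξ : HilbertTensor HA HB} (hn : ‖ξ‖ = 1)
    {PA : Label → HA →L[ℂ] HA} {PB : Label → HB →L[ℂ] HB}
    (hPA : ∀ p, IsStarProjection (PA p)) (hPB : ∀ p, IsStarProjection (PB p))
    (hCA : ∀ x : Fin 2, PA (0, x) + PA (1, x) = 1) (hCB : ∀ x : Fin 2, PB (0, x) + PB (1, x) = 1)
    (hξ : IsUniqueThetaMaximizer (exclusivityGraph I) w
      (vectorMatrix ξ fun i : I => tensorOp (PA i.1.1) (PB i.1.2) ξ))
    (hne : ∀ i : I, tensorOp (PA i.1.1) (PB i.1.2) ξ ≠ 0) (i j : I) :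
    tensorOp (PA i.1.1) (PB i.1.2) (tensorOp (PA j.1.1) (PB j.1.2) ξ)
      = (inner ℂ (tensorOp (PA i.1.1) (PB i.1.2) ξ) (tensorOp (PA j.1.1) (PB j.1.2) ξ)
        / inner ℂ (tensorOp (PA i.1.1) (PB i.1.2) ξ) (tensorOp (PA i.1.1) (PB i.1.2) ξ))
        • tensorOp (PA i.1.1) (PB i.1.2) ξ := by
  have hA : ∀ p, PA p * PA p = PA p := fun p => (hPA p).isIdempotentElem
  have hB : ∀ p, PB p * PB p = PB p := fun p => (hPB p).isIdempotentElem
  -- The algebra is generated by the local projections and not only by the joint ones, because the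
  -- centrality of corners uses the commuting pairs.
  let A : Label → HilbertTensor HA HB →L[ℂ] HilbertTensor HA HB := fun p => tensorOp (PA p) 1
  let B : Label → HilbertTensor HA HB →L[ℂ] HilbertTensor HA HB := fun q => tensorOp 1 (PB q)
  have hAB : ∀ p q, A p * B q = tensorOp (PA p) (PB q) := fun p q => by
    simp only [A, B, tensorOp_mul_tensorOp, mul_one, one_mul]
  have hBA : ∀ p q, B q * A p = tensorOp (PA p) (PB q) := fun p q => by
    simp only [A, B, tensorOp_mul_tensorOp, mul_one, one_mul]
  have hA1 : ∀ x : Fin 2, A (0, x) + A (1, x) = 1 := fun x => by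
    have : PA (0, x) = 1 - PA (1, x) := eq_sub_of_add_eq (hCA x)
    simp only [A, this, tensorOp_sub_left, tensorOp_one, sub_add_cancel]
  have hB1 : ∀ x : Fin 2, B (0, x) + B (1, x) = 1 := fun x => by
    have : PB (0, x) = 1 - PB (1, x) := eq_sub_of_add_eq (hCB x)
    simp only [B, this, tensorOp_sub_right, tensorOp_one, sub_add_cancel]
  have hpos : 0 < thetaObjective w
      (vectorMatrix ξ fun i : I => tensorOp (PA i.1.1) (PB i.1.2) ξ) := by
    refine Finset.sum_pos (fun k _ => mul_pos (hw k) ?_) ⟨i, Finset.mem_univ _⟩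
    change 0 < (inner ℂ (tensorOp (PA k.1.1) (PB k.1.2) ξ)
      (tensorOp (PA k.1.1) (PB k.1.2) ξ)).re
    exact RCLike.re_to_complex ▸ re_inner_self_pos.2 (hne k)
  refine hξ.apply_apply_eq_smul (P := fun i : I => tensorOp (PA i.1.1) (PB i.1.2))
    (fun i => (hw i).le) (fun i => isStarProjection_tensorOp (hPA _) (hPB _))
    (tensorOp_mul_eq_zero_of_adj hA hB hCA hCB) hn hpos
    (Algebra.adjoin ℂ (Set.range A ∪ Set.range B)) (fun k => ?_) (fun k m hm => ?_) (hne i) j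
  · rw [← hAB]
    exact Subalgebra.mul_mem _ (Algebra.subset_adjoin (Or.inl ⟨_, rfl⟩))
      (Algebra.subset_adjoin (Or.inr ⟨_, rfl⟩))
  · have := exists_central_corner (A := A) (B := B)
      (fun p => by simp only [A, tensorOp_mul_tensorOp, hA, mul_one])
      (fun p => by simp only [B, tensorOp_mul_tensorOp, hB, mul_one]) hA1 hB1
      (fun p q => (hAB p q).trans (hBA p q).symm) k.1.1 k.1.2 hm
    simpa only [hAB] using this

/-- The overlaps of the reference vectors of Bob's measurements carry over to a vector `y` on which
the projections act as in the reference system. -/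
theorem tensorOp_one_sandwich {PA : Label → HA →L[ℂ] HA} {PB : Label → HB →L[ℂ] HB}
    (hA : ∀ p, PA p * PA p = PA p) (hB : ∀ q, PB q * PB q = PB q)
    (hCB : ∀ x : Fin 2, PB (0, x) + PB (1, x) = 1) {b : Label → Qubit} (hb : IsBinaryPair b)
    {p q q' : Label} (hne : q'.2 ≠ q.2) {y : HilbertTensor HA HB}
    (hy : tensorOp (PA p) (PB q) y = y)
    (hy' : tensorOp (PA p * PA p * PA p) (PB q * PB q' * PB q) y
      = (inner ℂ (b q') (b q) * inner ℂ (b q) (b q')) • y) (s : Label) :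
    tensorOp 1 (PB q * PB s * PB q) y = (inner ℂ (b s) (b q) * inner ℂ (b q) (b s)) • y := by
  have hQ : tensorOp 1 (PB q) y = y := by
    conv_rhs => rw [← hy]
    conv_lhs => rw [← hy]
    rw [← mul_apply_eq_comp, tensorOp_mul_tensorOp, one_mul, hB]
  have hinner : ∀ s : Label, inner ℂ (b s) (b s) = (1 : ℂ) := fun s => by
    rw [inner_self_eq_norm_sq_to_K, hb.1]; simp
  have other : ∀ s, tensorOp (1 : HA →L[ℂ] HA) (PB q * PB s * PB q) y
        = (inner ℂ (b s) (b q) * inner ℂ (b q) (b s)) • y →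
      tensorOp (1 : HA →L[ℂ] HA) (PB q * PB (otherOutcome s) * PB q) y
        = (inner ℂ (b (otherOutcome s)) (b q) * inner ℂ (b q) (b (otherOutcome s))) • y := by
    intro s hs
    have e := inner_eq_of_orthonormal (hb.1 s) (hb.1 (otherOutcome s))
      (hb.inner_otherOutcome s) (b q) (b q)
    rw [hinner] at e
    have e' : inner ℂ (b (otherOutcome s)) (b q) * inner ℂ (b q) (b (otherOutcome s))
        = 1 - inner ℂ (b s) (b q) * inner ℂ (b q) (b s) := by rw [e]; ring
    rw [otherOutcome_eq_one_sub hCB, mul_sub, sub_mul, mul_one, hB, tensorOp_sub_right,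
      _root_.sub_apply, hs, hQ, e', sub_smul, one_smul]
  have h1 : tensorOp 1 (PB q * PB q * PB q) y
      = (inner ℂ (b q) (b q) * inner ℂ (b q) (b q)) • y := by
    rw [hB, hB, hQ, hinner, one_mul, one_smul]
  -- Alice's factor reduces to `PA p`, which is absorbed by `y`; this isolates Bob's operator.
  have h2 : tensorOp 1 (PB q * PB q' * PB q) y
      = (inner ℂ (b q') (b q) * inner ℂ (b q) (b q')) • y := by
    rw [← hy', hA, hA]
    conv_lhs => rw [← hy]
    rw [← mul_apply_eq_comp, tensorOp_mul_tensorOp, one_mul, mul_assoc _ (PB q), hB]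
  by_cases hr : s.2 = q.2
  · rcases eq_or_eq_otherOutcome hr with rfl | rfl
    · exact h1
    · exact other _ h1
  · rcases eq_or_eq_otherOutcome_of_ne hne hr with rfl | rfl
    · exact h2
    · exact other _ h2

end Realization

/-! ### Assembly of the local isometries and the junk state. -/

theorem theorem3
    -- the events, their weights
    (I : Finset (Label × Label)) (w : I → ℝ) (hw : ∀ i, 0 < w i)
    -- the reference state, vectors and amplitudes
    (ψ : Qubit ⊗[ℂ] Qubit) (hψ : ‖ψ‖ = 1) (a b : Label → Qubit)
    (ha : IsBinaryPair a) (hb : IsBinaryPair b)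
    (η : I → ℂ) (hη : ∀ i, η i ≠ 0)
    -- the reference system gives the unique optimal solution
    (hopt : IsUniqueThetaMaximizer (exclusivityGraph I) w
      (vectorMatrix ψ fun i : I => η i • (a i.1.1 ⊗ₜ[ℂ] b i.1.2)))
    -- the reference vectors span
    (hspan : Submodule.span ℂ
      (insert ψ (Set.range fun i : I => a i.1.1 ⊗ₜ[ℂ] b i.1.2)) = ⊤)
    (hlink : HasLinkedSpanningEvents I a b)
    -- an arbitrary realization with projections of arbitrary rank
    {HA : Type u} [NormedAddCommGroup HA] [InnerProductSpace ℂ HA] [CompleteSpace HA]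
    {HB : Type v} [NormedAddCommGroup HB] [InnerProductSpace ℂ HB] [CompleteSpace HB]
    (ψ' : HilbertTensor HA HB) (hψ' : ‖ψ'‖ = 1)
    (PA : Label → HA →L[ℂ] HA) (PB : Label → HB →L[ℂ] HB)
    (hPA : ∀ p, IsStarProjection (PA p)) (hPB : ∀ p, IsStarProjection (PB p))
    -- the two projections of each measurement sum to the identity
    (hCA : ∀ x : Fin 2, PA (0, x) + PA (1, x) = 1)
    (hCB : ∀ x : Fin 2, PB (0, x) + PB (1, x) = 1)
    -- the realization is optimal
    (hopt' : IsThetaMaximizer (exclusivityGraph I) w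
      (vectorMatrix ψ' fun i : I => tensorOp (PA i.1.1) (PB i.1.2) ψ')) :
    ∃ (KA : Type u) (_ : NormedAddCommGroup KA) (_ : InnerProductSpace ℂ KA)
      (_ : CompleteSpace KA)
      (KB : Type v) (_ : NormedAddCommGroup KB) (_ : InnerProductSpace ℂ KB)
      (_ : CompleteSpace KB)
      (VA : HilbertTensor Qubit KA →ₗᵢ[ℂ] HA) (VB : HilbertTensor Qubit KB →ₗᵢ[ℂ] HB)
      (junk : HilbertTensor KA KB), ‖junk‖ = 1 ∧
      tensorOp VA.toContinuousLinearMap VB.toContinuousLinearMap (attach ψ junk) = ψ' ∧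
      ∀ i : I,
        tensorOp VA.toContinuousLinearMap VB.toContinuousLinearMap
            (attach (a i.1.1 ⊗ₜ[ℂ] b i.1.2) junk) =
          (η i)⁻¹ • tensorOp (PA i.1.1) (PB i.1.2) ψ' := by
  have hA : ∀ p, PA p * PA p = PA p := fun p => (hPA p).isIdempotentElem
  have hB : ∀ p, PB p * PB p = PB p := fun p => (hPB p).isIdempotentElem
  set v : I → Qubit ⊗[ℂ] Qubit := fun i => a i.1.1 ⊗ₜ[ℂ] b i.1.2 with hv
  have hsl : ∀ (c : ℂ) (x y : Qubit ⊗[ℂ] Qubit), inner ℂ (c • x) y = star c * inner ℂ x y :=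
    fun c x y => inner_smul_left x y c
  have hsr : ∀ (c : ℂ) (x y : Qubit ⊗[ℂ] Qubit), inner ℂ x (c • y) = c * inner ℂ x y :=
    fun c x y => inner_smul_right x y c
  have hself : ∀ x : Qubit ⊗[ℂ] Qubit, ‖x‖ = 1 → inner ℂ x x = (1 : ℂ) := fun x hx =>
    (inner_self_eq_norm_sq_to_K x).trans (by simp [hx])
  have hsym : ∀ x y : Qubit ⊗[ℂ] Qubit, inner ℂ x y = (0 : ℂ) → inner ℂ y x = (0 : ℂ) :=
    fun x y h => inner_eq_zero_symm (𝕜 := ℂ) (x := x) (y := y) |>.1 h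
  have hsuml : ∀ (f : I → Qubit ⊗[ℂ] Qubit) (y : Qubit ⊗[ℂ] Qubit),
      inner ℂ (∑ i, f i) y = ∑ i, inner ℂ (f i) y := fun f y => sum_inner _ f y
  have hsumr : ∀ (f : I → Qubit ⊗[ℂ] Qubit) (y : Qubit ⊗[ℂ] Qubit),
      inner ℂ y (∑ i, f i) = ∑ i, inner ℂ y (f i) := fun f y => inner_sum _ f y
  have hunit : ∀ x : HilbertTensor HA HB, inner ℂ x x = (1 : ℂ) → ‖x‖ = 1 := fun x hx => by
    rw [inner_self_eq_norm_sq_to_K] at hx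
    simp only [Complex.coe_algebraMap] at hx
    exact (pow_eq_one_iff_of_nonneg (norm_nonneg _) two_ne_zero).1 (by exact_mod_cast hx)
  have hvn : ∀ i, ‖v i‖ = 1 := fun i => by
    rw [hv]; simp only [TensorProduct.norm_tmul, ha.1, hb.1, mul_one]
  have hv0 : ∀ i, v i ≠ 0 := fun i h => by simpa [h] using hvn i
  have hconn : ∀ T : Set I, (∀ i ∈ T, ∀ j ∉ T, inner ℂ (v i) (v j) = 0) → T.Nonempty →
      ∀ j, j ∈ T := fun T hT hne j => hopt.mem_of_inner_eq_zero hη hv0 hT hne j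
  obtain ⟨p, p', q, q', r, hpq, hpq', hpr, hp, hq, ha1, ha2, hb1, hb2, hbr⟩ :=
    exists_linked_events ha hb hconn hlink
  have hX := hopt.2 _ hopt'
  have hξ := hopt
  rw [← hX] at hξ
  have hgram : ∀ i j : I, inner ℂ (tensorOp (PA i.1.1) (PB i.1.2) ψ')
      (tensorOp (PA j.1.1) (PB j.1.2) ψ') = star (η i) * η j * inner ℂ (v i) (v j) := by
    intro i j
    have e : inner ℂ (tensorOp (PA i.1.1) (PB i.1.2) ψ') (tensorOp (PA j.1.1) (PB j.1.2) ψ')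
        = inner ℂ (η i • v i) (η j • v j) := congrFun (congrFun hX (some j)) (some i)
    rw [e, hsl, hsr]
    ring
  have hgram0 : ∀ i : I, inner ℂ (tensorOp (PA i.1.1) (PB i.1.2) ψ') ψ'
      = star (η i) * inner ℂ (v i) ψ := by
    intro i
    have e : inner ℂ (tensorOp (PA i.1.1) (PB i.1.2) ψ') ψ'
        = inner ℂ (η i • v i) ψ := congrFun (congrFun hX none) (some i)
    rw [e, hsl]
  have hηs : ∀ i, star (η i) ≠ 0 := fun i => star_ne_zero.2 (hη i)
  have hvv : ∀ i, inner ℂ (v i) (v i) = (1 : ℂ) := fun i => hself _ (hvn i)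
  have hne : ∀ i : I, tensorOp (PA i.1.1) (PB i.1.2) ψ' ≠ 0 := fun i => by
    rw [← inner_self_ne_zero (𝕜 := ℂ), hgram, hvv, mul_one]
    exact mul_ne_zero (hηs i) (hη i)
  set v' : I → HilbertTensor HA HB := fun i => (η i)⁻¹ • tensorOp (PA i.1.1) (PB i.1.2) ψ'
    with hv'
  -- Dividing by the amplitudes `η` turns the rigidity statement into the action rule of the
  -- reference rank one projections.
  have hact : ∀ i j : I, tensorOp (PA i.1.1) (PB i.1.2) (v' j) = inner ℂ (v i) (v j) • v' i := by
    intro i j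
    have hηi := hη i
    have hηj := hη j
    have hηsi := hηs i
    rw [hv']
    simp only [map_smul]
    rw [tensorOp_apply_eq_smul hw hψ' hPA hPB hCA hCB hξ hne, hgram, hgram, hvv, smul_smul,
      smul_smul]
    congr 1
    field_simp
  have hgram' : ∀ i j : I, inner ℂ (v' i) (v' j) = inner ℂ (v i) (v j) := by
    intro i j
    have hηj := hη j
    have hηsi := hηs i
    simp only [hv']
    rw [inner_smul_left, inner_smul_right, hgram, map_inv₀]
    change (star (η i))⁻¹ * _ = _
    field_simp
  let i₀ : I := ⟨(p, q), hpq⟩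
  set y := v' i₀ with hy
  have hyfix : tensorOp (PA p) (PB q) y = y := by
    have := hact i₀ i₀
    rwa [hvv, one_smul] at this
  have hyn : ‖y‖ = 1 := hunit _ ((hgram' i₀ i₀).trans (hvv i₀))
  have hsand : ∀ i : I, tensorOp (PA p * PA i.1.1 * PA p) (PB q * PB i.1.2 * PB q) y
      = (inner ℂ (v i) (v i₀) * inner ℂ (v i₀) (v i)) • y := by
    intro i
    rw [← tensorOp_mul_tensorOp, ← tensorOp_mul_tensorOp, mul_apply_eq_comp, mul_apply_eq_comp,
      hyfix, hy, hact i i₀, map_smul]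
    have := hact i₀ i
    change tensorOp (PA p) (PB q) (v' i) = _ at this
    rw [this, smul_smul]
  have haa : ∀ p, inner ℂ (a p) (a p) = (1 : ℂ) := fun p => by
    rw [inner_self_eq_norm_sq_to_K, ha.1]; simp
  -- The event `(p, q')` shares Alice's label with `(p, q)`, so its overlap is Bob's alone.
  have hBob := tensorOp_one_sandwich hA hB hCB hb hq hyfix (by
    have := hsand ⟨(p, q'), hpq'⟩
    simpa only [hv, i₀, TensorProduct.inner_tmul, haa, one_mul] using this)
  have hyB : tensorOp (1 : HA →L[ℂ] HA) (blockDefect (PB q) (PB q') (inner ℂ (b q') (b q))) y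
      = 0 := by
    rw [blockDefect, tensorOp_sub_right, tensorOp_smul_right, tensorOp_one, _root_.sub_apply,
      hBob, ← inner_conj_symm (b q) (b q')]
    exact sub_self _
  have hyA : tensorOp (blockDefect (PA p) (PA p') (inner ℂ (a p') (a p))) (1 : HB →L[ℂ] HB) y
      = 0 := by
    -- This event mixes both parties, but Bob's factor is already known and is nonzero by `hbr`;
    -- dividing by it leaves Alice's angle.
    have h1 := hsand ⟨(p', r), hpr⟩
    simp only [hv, i₀, TensorProduct.inner_tmul] at h1
    have h2 : tensorOp (PA p * PA p' * PA p) (PB q * PB r * PB q)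
        = tensorOp (PA p * PA p' * PA p) 1 * tensorOp 1 (PB q * PB r * PB q) := by
      rw [tensorOp_mul_tensorOp, one_mul, mul_one]
    rw [h2, mul_apply_eq_comp, hBob, map_smul] at h1
    have hc : inner ℂ (b r) (b q) * inner ℂ (b q) (b r) ≠ 0 :=
      mul_ne_zero hbr fun h => hbr (inner_eq_zero_symm.1 h)
    have h3 : tensorOp (PA p * PA p' * PA p) (1 : HB →L[ℂ] HB) y
        = (inner ℂ (a p') (a p) * inner ℂ (a p) (a p')) • y := by
      refine smul_right_injective _ hc ?_
      have e : (inner ℂ (a p') (a p) * inner ℂ (b r) (b q)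
          * (inner ℂ (a p) (a p') * inner ℂ (b q) (b r)) : ℂ)
          = inner ℂ (b r) (b q) * inner ℂ (b q) (b r)
          * (inner ℂ (a p') (a p) * inner ℂ (a p) (a p')) := by ring
      rw [e] at h1
      exact h1.trans (mul_smul _ _ y)
    rw [blockDefect, tensorOp_sub_left, tensorOp_smul_left, tensorOp_one, _root_.sub_apply,
      h3, ← inner_conj_symm (a p) (a p')]
    exact sub_self _
  have hexA := exists_local_isometry hPA hCA ha hp ha1 ha2
  have hexB := exists_local_isometry hPB hCB hb hq hb1 hb2
  have hsaA := isSelfAdjoint_blockDefect (hPA p) (hPA p') (inner ℂ (a p') (a p))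
  have hsaB := isSelfAdjoint_blockDefect (hPB q) (hPB q') (inner ℂ (b q') (b q))
  generalize blockDefect (PA p) (PA p') (inner ℂ (a p') (a p)) = DA at hexA hsaA hyA
  generalize blockDefect (PB q) (PB q') (inner ℂ (b q') (b q)) = DB at hexB hsaB hyB
  obtain ⟨VA, hVA, hVA'⟩ := hexA
  obtain ⟨VB, hVB, hVB'⟩ := hexB
  -- As both defect operators annihilate `y`, it lies in the tensor product of their kernels, so
  -- projecting loses nothing and the junk state is `y` itself.
  let junk : HilbertTensor DA.ker DB.ker :=
    tensorOp DA.ker.orthogonalProjectionOnto DB.ker.orthogonalProjectionOnto y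
  have hjunk : tensorOp DA.ker.subtypeL DB.ker.subtypeL junk = y := by
    simp only [junk]
    rw [tensorOp_tensorOp]
    change tensorOp DA.ker.starProjection DB.ker.starProjection y = y
    have e : tensorOp DA.ker.starProjection DB.ker.starProjection
        = tensorOp DA.ker.starProjection 1 * tensorOp 1 DB.ker.starProjection := by
      rw [tensorOp_mul_tensorOp, one_mul, mul_one]
    rw [e, mul_apply_eq_comp, tensorOp_starProjection_ker_right hsaB hyB,
      tensorOp_starProjection_ker_left hsaA hyA]
  have hjn : ‖junk‖ = 1 := by
    rw [← hyn, ← hjunk]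
    exact (norm_tensorOp_isometry DA.ker.subtypeₗᵢ DB.ker.subtypeₗᵢ junk).symm
  let U : Qubit ⊗[ℂ] Qubit → HilbertTensor HA HB := fun x =>
    tensorOp VA.toContinuousLinearMap VB.toContinuousLinearMap (attach x junk)
  have hUadd : ∀ x y, U (x + y) = U x + U y := fun x y => by
    simp only [U, map_add, _root_.add_apply]
  have hUsmul : ∀ (c : ℂ) x, U (c • x) = c • U x := fun c x => by
    simp only [U, map_smul, _root_.smul_apply]
  have hUt : ∀ x y, U (x ⊗ₜ y) = tensorOp (VA.toContinuousLinearMap.comp (adjoinVec x))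
      (VB.toContinuousLinearMap.comp (adjoinVec y)) junk := fun x y =>
    tensorOp_tensorOp VA.toContinuousLinearMap VB.toContinuousLinearMap (adjoinVec x)
      (adjoinVec y) junk
  have hU₀ : U (v i₀) = y := by
    conv_rhs => rw [← hjunk]
    refine (hUt _ _).trans ?_
    congr 2
    · exact ContinuousLinearMap.ext fun k => hVA k
    · exact ContinuousLinearMap.ext fun k => hVB k
  have hUact : ∀ i j : I, tensorOp (PA i.1.1) (PB i.1.2) (U (v j))
      = inner ℂ (v i) (v j) • U (v i) := by
    intro i j
    simp only [hv]
    rw [hUt, hUt, tensorOp_tensorOp, TensorProduct.inner_tmul]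
    have eA : (PA i.1.1).comp (VA.toContinuousLinearMap.comp (adjoinVec (a j.1.1)))
        = inner ℂ (a i.1.1) (a j.1.1) • VA.toContinuousLinearMap.comp (adjoinVec (a i.1.1)) :=
      ContinuousLinearMap.ext fun k => hVA' _ _ k
    have eB : (PB i.1.2).comp (VB.toContinuousLinearMap.comp (adjoinVec (b j.1.2)))
        = inner ℂ (b i.1.2) (b j.1.2) • VB.toContinuousLinearMap.comp (adjoinVec (b i.1.2)) :=
      ContinuousLinearMap.ext fun k => hVB' _ _ k
    rw [eA, eB, tensorOp_smul_left, tensorOp_smul_right, smul_smul, _root_.smul_apply]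
  -- Both families obey the same action rule: agreement at `i` passes to any `j` with `⟨v_j, v_i⟩ ≠
  -- 0` by applying the projection of `j`, and connectedness does the rest.
  have hUv : ∀ i, U (v i) = v' i := by
    refine hconn {i | U (v i) = v' i} (fun i hi j hj => ?_) ⟨i₀, hU₀⟩
    by_contra hij
    have hji : inner ℂ (v j) (v i) ≠ 0 := fun h => hij (hsym _ _ h)
    refine hj (smul_right_injective _ hji ?_)
    simp only
    rw [← hUact, ← hact, hi]
  refine ⟨DA.ker, inferInstance, inferInstance, inferInstance, DB.ker, inferInstance,
    inferInstance, inferInstance, VA, VB, junk, hjn, ?_, hUv⟩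
  change U ψ = ψ'
  have hψspan : ψ ∈ Submodule.span ℂ (Set.range v) := by
    rw [hlink.span_eq_top]; trivial
  obtain ⟨c, hc⟩ := (Submodule.mem_span_range_iff_exists_fun ℂ).1 hψspan
  have hUsum : U ψ = ∑ i, c i • v' i := by
    let UL : Qubit ⊗[ℂ] Qubit →ₗ[ℂ] HilbertTensor HA HB :=
      { toFun := U, map_add' := hUadd, map_smul' := hUsmul }
    have h1 : UL ψ = ∑ i, c i • UL (v i) := by rw [← hc, map_sum]; simp only [map_smul]
    have h2 : U ψ = ∑ i, c i • U (v i) := h1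
    simp only [h2, hUv]
  have hv'ψ : ∀ i, inner ℂ (v' i) ψ' = inner ℂ (v i) ψ := fun i => by
    have hηsi := hηs i
    simp only [hv']
    rw [inner_smul_left, hgram0, map_inv₀]
    change (star (η i))⁻¹ * _ = _
    field_simp
  -- Expanding `ψ` in the `v i`, the Gram data give inner product `1` between two unit vectors,
  -- which forces equality.
  have h1 : inner ℂ (U ψ) ψ' = (1 : ℂ) := by
    have e : inner ℂ ψ ψ = ∑ i, star (c i) * inner ℂ (v i) ψ := by
      conv_lhs => enter [2]; rw [← hc]
      rw [hsuml]
      simp only [hsl]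
    rw [hUsum, sum_inner, ← hself ψ hψ, e]
    simp only [inner_smul_left, hv'ψ]
    rfl
  have h2 : inner ℂ (U ψ) (U ψ) = (1 : ℂ) := by
    rw [hUsum, ← hself ψ hψ, ← hc]
    rw [sum_inner, hsuml]
    refine Finset.sum_congr rfl fun i _ => ?_
    rw [inner_smul_left, hsl, inner_sum, hsumr]
    refine congrArg (star (c i) * ·) (Finset.sum_congr rfl fun j _ => ?_)
    rw [inner_smul_right, hsr, hgram']
  exact (inner_eq_one_iff_of_norm_eq_one (hunit _ h2) hψ').1 h1
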